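/- Let $\lambda,h,R>0$. Put $$K(x,y)=e^{-\frac{1}{8\lambda}(1-x^2)^2}\,e^{-\frac{\lambda}{2h^2}(x-y)^2}\,e^{-\frac{1}{8\lambda}(1-y^2)^2},\qquad c_\lambda=e^{-\frac1{4\lambda}},$$ let $\mathcal H_0:L^2([-R,R])\to L^2([-R,R])$, $\mathcal H_0[\phi](x)=\int_{-R}^RK(x,y)\phi(y)\,dy$, and for $d\ge1$ $$\mathcal H[\phi_1,\dots,\phi_d]=c_\lambda\int_{[-R,R]^d}K(0,x_1)K(x_1,x_2)\cdots K(x_{d-1},x_d)K(x_d,0)\,\phi_1(x_1)\cdots\phi_d(x_d)\,dx_1\cdots dx_d .$$ (1) $\mathcal H_0$ is compact, symmetric and positive semi-definite, and it has an eigendecomposition: there are continuous functions $u_1,u_2,\dots$ on $[-R,R]$ forming an orthonormal basis of $L^2([-R,R])$ and numbers $\lambda_1\ge\lambda_2\ge\dots\ge0$ with $\mathcal H_0u_j=\lambda_ju_j$. For any eigendecomposition as in (1) let $v_j=\sqrt{\lambda_j}\,u_j$ and $A_{j,\ell}^n=\int_{-R}^Rv_j(x)v_\ell(x)T_n(x/R)\,dx$,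 where $T_n$ is the $n$-th Chebyshev polynomial. For $\phi$ continuous on $[-R,R]$ let $\phi_{,n}=\frac{2}{\pi}\int_0^\pi\phi(R\cos\theta)\cos(n\theta)\,d\theta$ for $n\ge1$, and the same with $\frac1\pi$ in place of $\frac2\pi$ for $n=0$, be its Chebyshev coefficients; write $\phi_{i,n}$ for those of $\phi_i$. For $J\ge 1$, $N\ge0$ let $$\mathcal H^{(J,N)}[\phi_1,\dots,\phi_d]=c_\lambda\sum_{j_0,\dots,j_d=1}^{J}\ \sum_{n_1,\dots,n_d=0}^{N}v_{j_0}(0)\,A^{n_1}_{j_0,j_1}\cdots A^{n_d}_{j_{d-1},j_d}\,v_{j_d}(0)\,\phi_{1,n_1}\cdots\phi_{d,n_d}.$$ (2) For every $d\ge1$ and $\alpha>0$ there is a constant $M>0$, depending only on $\alpha,\lambda,h,d,R$, such that the following holds for every eigendecomposition as in (1). The sum $\mathrm{Tr}(\mathcal H_0)=\sum_j\lambda_j$ converges, and for all integers $J\ge1$, $p\ge1$, $N>p$ and all $\phi_1,\dots,\phi_d\in C^{p+1}([-R,R])$ one has $\phi_i(x)=\sum_{n\ge0}\phi_{i,n}T_n(x/R)$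 for $x\in[-R,R]$ and, with $$V_p=\max_i\Big\|\tfrac{d^{p+1}}{dt^{p+1}}\,\phi_i(Rt)\Big\|_{L^1([-1,1])},\qquad \varepsilon=\frac{2V_p}{\pi p(N-p)^p},\qquad \|\cdot\|_\infty=\|\cdot\|_{L^\infty([-R,R])},$$ $$\big|\mathcal H[\phi_1,\dots,\phi_d]-\mathcal H^{(J,N)}[\phi_1,\dots,\phi_d]\big|\le M e^{-\alpha J/2}\prod_{i=1}^d\|\phi_i\|_\infty+d\,c_\lambda\,\varepsilon\,\big(\max_i\|\phi_i\|_\infty+\varepsilon\big)^{d-1}K(0,0)\,\mathrm{Tr}(\mathcal H_0)^d .$$ If moreover $\max_i\|\phi_i\|_\infty\ge1$, then also $$\big|\mathcal H[\phi_1,\dots,\phi_d]-\mathcal H^{(J,N)}[\phi_1,\dots,\phi_d]\big|\le M e^{-\alpha J/2}\prod_{i=1}^d\|\phi_i\|_\infty+d\,c_\lambda\,\varepsilon\,(1+\varepsilon)^{d-1}K(0,0)\,\mathrm{Tr}(\mathcal H_0)^d\max_i\|\phi_i\|_\infty^{d-1}.$$ -/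

import Mathlib

open MeasureTheory Set
open scoped ENNReal

namespace GinzburgLandau

noncomputable section

/-- Lebesgue measure on the interval `[-R, R]`. -/
abbrev muI (R : ℝ) : Measure ℝ := volume.restrict (Icc (-R) R)

/-- The real Hilbert space `L²([-R, R])`. -/
abbrev L2I (R : ℝ) : Type := Lp ℝ 2 (muI R)

/-- The Ginzburg-Landau kernel
`K(x,y) = exp(-(1-x²)²/(8λ)) exp(-λ(x-y)²/(2h²)) exp(-(1-y²)²/(8λ))`. -/
def kernel (lam h x y : ℝ) : ℝ :=
  Real.exp (-(1 / (8 * lam)) * (1 - x ^ 2) ^ 2) *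
    Real.exp (-(lam / (2 * h ^ 2)) * (x - y) ^ 2) *
      Real.exp (-(1 / (8 * lam)) * (1 - y ^ 2) ^ 2)

theorem continuous_kernel (lam h : ℝ) :
    Continuous (fun z : ℝ × ℝ => kernel lam h z.1 z.2) := by
  unfold kernel
  fun_prop

theorem exists_kernel_bound (lam h R : ℝ) :
    ∃ C : ℝ, 0 ≤ C ∧ ∀ x ∈ Icc (-R) R, ∀ y ∈ Icc (-R) R, ‖kernel lam h x y‖ ≤ C := by
  obtain ⟨C, hC⟩ := ((isCompact_Icc (a := -R) (b := R)).prod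
    (isCompact_Icc (a := -R) (b := R))).exists_bound_of_continuousOn
      (continuous_kernel lam h).continuousOn
  exact ⟨max C 0, le_max_right _ _, fun x hx y hy => (hC (x, y) ⟨hx, hy⟩).trans (le_max_left _ _)⟩

theorem integrable_L2I {R : ℝ} (f : L2I R) : Integrable (fun y => f y) (muI R) :=
  (Lp.memLp f).integrable (by norm_num)

theorem integrable_kernel_mul (lam h : ℝ) {R : ℝ} (f : L2I R) {x : ℝ} (hx : x ∈ Icc (-R) R) :
    Integrable (fun y => kernel lam h x y * f y) (muI R) := by
  obtain ⟨C, _, hC⟩ := exists_kernel_bound lam h R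
  refine (integrable_L2I f).bdd_mul (c := C) ?_ ?_
  · exact ((continuous_kernel lam h).comp (Continuous.prodMk_right x)).aestronglyMeasurable
  · filter_upwards [ae_restrict_mem measurableSet_Icc] with y hy using hC x hx y hy

/-- `∫_{-R}^R |f| ≤ sqrt (2R) ‖f‖₂`, with the square root written as a power of the total mass. -/
theorem integral_norm_le {R : ℝ} (f : L2I R) :
    ∫ y, ‖f y‖ ∂(muI R) ≤ ‖f‖ * ((muI R) univ ^ (1 / 2 : ℝ)).toReal := by
  have h1 := eLpNorm_le_eLpNorm_mul_rpow_measure_univ (μ := muI R) (f := fun y => f y)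
    (p := 1) (q := 2) (by norm_num) (Lp.memLp f).1
  have h2 : (1 / (1 : ℝ≥0∞).toReal - 1 / (2 : ℝ≥0∞).toReal) = (1 / 2 : ℝ) := by norm_num
  rw [h2] at h1
  rw [integral_norm_eq_lintegral_enorm (Lp.memLp f).1, ← eLpNorm_one_eq_lintegral_enorm,
    Lp.norm_def, ← ENNReal.toReal_mul]
  refine ENNReal.toReal_mono ?_ h1
  exact ENNReal.mul_ne_top (Lp.eLpNorm_ne_top f)
    (ENNReal.rpow_ne_top_of_nonneg (by norm_num) (measure_ne_top _ _))

theorem norm_integral_kernel_le {lam h R C : ℝ}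
    (hC : ∀ x ∈ Icc (-R) R, ∀ y ∈ Icc (-R) R, ‖kernel lam h x y‖ ≤ C) (f : L2I R) {x : ℝ}
    (hx : x ∈ Icc (-R) R) :
    ‖∫ y, kernel lam h x y * f y ∂(muI R)‖ ≤ C * ∫ y, ‖f y‖ ∂(muI R) := by
  rw [← integral_const_mul]
  refine norm_integral_le_of_norm_le ((integrable_L2I f).norm.const_mul C) ?_
  filter_upwards [ae_restrict_mem measurableSet_Icc] with y hy
  rw [norm_mul]
  exact mul_le_mul_of_nonneg_right (hC x hx y hy) (norm_nonneg _)

theorem memLp_integral_kernel (lam h : ℝ) {R : ℝ} (f : L2I R) :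
    MemLp (fun x => ∫ y, kernel lam h x y * f y ∂(muI R)) 2 (muI R) := by
  obtain ⟨C, _, hC⟩ := exists_kernel_bound lam h R
  refine MemLp.of_bound ?_ (C * ∫ y, ‖f y‖ ∂(muI R)) ?_
  · refine StronglyMeasurable.aestronglyMeasurable ?_
    exact StronglyMeasurable.integral_prod_right'
      (f := fun z : ℝ × ℝ => kernel lam h z.1 z.2 * f z.2)
      ((continuous_kernel lam h).stronglyMeasurable.mul
        ((Lp.stronglyMeasurable f).comp_measurable measurable_snd))
  · filter_upwards [ae_restrict_mem measurableSet_Icc] with x hx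
    exact norm_integral_kernel_le hC f hx

/-- The integral operator `H₀ f (x) = ∫_{-R}^R K(x,y) f(y) dy` on `L²([-R, R])`. -/
def opH0 (lam h R : ℝ) : L2I R →L[ℝ] L2I R :=
  LinearMap.mkContinuousOfExistsBound
    { toFun := fun f => (memLp_integral_kernel lam h f).toLp _
      map_add' := by
        intro f g
        rw [← MemLp.toLp_add, MemLp.toLp_eq_toLp_iff]
        filter_upwards [ae_restrict_mem measurableSet_Icc] with x hx
        rw [Pi.add_apply, ← integral_add (integrable_kernel_mul lam h f hx)
          (integrable_kernel_mul lam h g hx)]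
        refine integral_congr_ae ?_
        filter_upwards [Lp.coeFn_add f g] with y hy
        rw [hy, Pi.add_apply, mul_add]
      map_smul' := by
        intro c f
        rw [RingHom.id_apply, ← MemLp.toLp_const_smul, MemLp.toLp_eq_toLp_iff]
        refine Filter.Eventually.of_forall fun x => ?_
        rw [Pi.smul_apply, smul_eq_mul, ← integral_const_mul]
        refine integral_congr_ae ?_
        filter_upwards [Lp.coeFn_smul c f] with y hy
        rw [hy, Pi.smul_apply, smul_eq_mul]
        ring }
    (by
      obtain ⟨C, hC0, hC⟩ := exists_kernel_bound lam h R
      set m : ℝ := ((muI R) univ ^ (1 / 2 : ℝ)).toReal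
      refine ⟨m * (C * m), fun f => ?_⟩
      have hb : ∀ᵐ x ∂(muI R), ‖((memLp_integral_kernel lam h f).toLp _ : L2I R) x‖ ≤
          C * (‖f‖ * m) := by
        filter_upwards [ae_restrict_mem measurableSet_Icc,
          (memLp_integral_kernel lam h f).coeFn_toLp] with x hx hx'
        rw [hx']
        exact (norm_integral_kernel_le hC f hx).trans
          (mul_le_mul_of_nonneg_left (integral_norm_le f) hC0)
      have hCm : 0 ≤ C * (‖f‖ * m) :=
        mul_nonneg hC0 (mul_nonneg (norm_nonneg _) ENNReal.toReal_nonneg)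
      have hle := Lp.norm_le_of_ae_bound hCm hb
      refine hle.trans (le_of_eq ?_)
      have hm : m = ((measureUnivNNReal (muI R) : ℝ) ^ ((2 : ℝ≥0∞).toReal⁻¹ : ℝ)) := by
        have h2 : ((2 : ℝ≥0∞).toReal⁻¹ : ℝ) = 1 / 2 := by norm_num
        rw [h2]
        exact (ENNReal.toReal_rpow _ _).symm
      rw [← hm]
      ring)

/-- `(ev j)`, `(u j)` (indexed from `0`) is an eigendecomposition of `H₀`: the functions `u j` are
continuous on `[-R, R]`, their classes form an orthonormal (Hilbert) basis of `L²([-R, R])`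
consisting of eigenvectors of `H₀`, and the eigenvalues are nonnegative and nonincreasing.
Continuity selects the representative that is evaluated at the point `0`. -/
structure IsEigendecomposition (lam h R : ℝ) (ev : ℕ → ℝ) (u : ℕ → ℝ → ℝ) : Prop where
  continuousOn : ∀ j, ContinuousOn (u j) (Icc (-R) R)
  nonneg : ∀ j, 0 ≤ ev j
  antitone : Antitone ev
  basis : ∃ b : HilbertBasis ℕ ℝ (L2I R),
    ∀ j, (b j : ℝ → ℝ) =ᵐ[muI R] u j ∧ opH0 lam h R (b j) = ev j • b j

/-- The normalisation `c_λ = exp(-1/(4λ))`. -/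
def cLam (lam : ℝ) : ℝ := Real.exp (-(1 / (4 * lam)))

/-- The chain `(x_0, x_1, …, x_d, x_{d+1}) = (0, x_1, …, x_d, 0)`. -/
def chain {d : ℕ} (x : Fin d → ℝ) : Fin (d + 2) → ℝ :=
  Fin.cons 0 (Fin.snoc x 0 : Fin (d + 1) → ℝ)

/-- The functional `H[φ_1, …, φ_d]`. -/
def funcH (lam h R : ℝ) {d : ℕ} (phi : Fin d → ℝ → ℝ) : ℝ :=
  cLam lam * ∫ x in univ.pi (fun _ : Fin d => Icc (-R) R),
    (∏ k : Fin (d + 1), kernel lam h (chain x k.castSucc) (chain x k.succ)) *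
      ∏ i : Fin d, phi i (x i)

/-- The rescaled eigenfunctions `v_j = sqrt(λ_j) u_j`. -/
def vFun (ev : ℕ → ℝ) (u : ℕ → ℝ → ℝ) (j : ℕ) (x : ℝ) : ℝ := Real.sqrt (ev j) * u j x

/-- `A_{j,l}[φ] = ∫_{-R}^R v_j v_l φ`. -/
def coefA (R : ℝ) (ev : ℕ → ℝ) (u : ℕ → ℝ → ℝ) (j l : ℕ) (f : ℝ → ℝ) : ℝ :=
  ∫ x in (-R)..R, vFun ev u j x * vFun ev u l x * f x

/-- The scaled Chebyshev polynomial `T_n(x/R)`. -/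
def chebT (R : ℝ) (n : ℕ) (x : ℝ) : ℝ := (Polynomial.Chebyshev.T ℝ n).eval (x / R)

/-- The `n`-th coefficient of the expansion of `f` in the scaled Chebyshev polynomials on
`[-R, R]`: `(2/π) ∫_0^π f(R cos θ) cos(nθ) dθ`, with `1/π` in place of `2/π` for `n = 0`. -/
def chebCoeff (R : ℝ) (f : ℝ → ℝ) (n : ℕ) : ℝ :=
  (if n = 0 then 1 else 2) / Real.pi *
    ∫ θ in (0 : ℝ)..Real.pi, f (R * Real.cos θ) * Real.cos (n * θ)

/-- `H^{(J,N)}[φ_1, …, φ_d]`: the eigenvalue sums run over the first `J` eigenvalues and the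
Chebyshev sums over `0 ≤ n_i ≤ N`. -/
def funcHTrunc (lam R : ℝ) (ev : ℕ → ℝ) (u : ℕ → ℝ → ℝ) (J N : ℕ) {d : ℕ}
    (phi : Fin d → ℝ → ℝ) : ℝ :=
  cLam lam * ∑ j : Fin (d + 1) → Fin J, ∑ n : Fin d → Fin (N + 1),
    vFun ev u (j 0) 0 *
      (∏ i : Fin d, coefA R ev u (j i.castSucc) (j i.succ) (chebT R (n i))) *
        vFun ev u (j (Fin.last d)) 0 * ∏ i : Fin d, chebCoeff R (phi i) (n i)

/-- The norm of `L^∞([-R, R])`. -/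
def supNorm (R : ℝ) (f : ℝ → ℝ) : ℝ := lpNorm f ∞ (muI R)

/-- `max_i ‖φ_i‖_∞`. -/
def maxSupNorm (R : ℝ) {d : ℕ} (phi : Fin d → ℝ → ℝ) : ℝ := ⨆ i, supNorm R (phi i)

/-- `V_p = max_i ‖d^{p+1}/dt^{p+1} φ_i(R t)‖_{L¹([-1,1])}`. -/
def Vp (R : ℝ) (p : ℕ) {d : ℕ} (phi : Fin d → ℝ → ℝ) : ℝ :=
  ⨆ i, ∫ t in (-1 : ℝ)..1,
    |iteratedDerivWithin (p + 1) (fun s => phi i (R * s)) (Icc (-1) 1) t|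

/-- `2 V_p / (π p (N-p)^p)`. -/
def chebTail (R : ℝ) (p N : ℕ) {d : ℕ} (phi : Fin d → ℝ → ℝ) : ℝ :=
  2 * Vp R p phi / (Real.pi * p * ((N : ℝ) - p) ^ p)

end

end GinzburgLandau

/-!
Expanding the exponential of `λ x y / h²` writes the kernel as `K(x, y) = ∑ₙ gₙ(x) gₙ(y)`, hence
`H₀ = ∑ₙ gₙ ⊗ gₙ`. Such a sum is compact and positive, and the trace is at most `∑ₙ ‖gₙ‖² < ∞`.
Since `∑_{n<J} gₙ ⊗ gₙ` has rank at most `J`, the eigenvalue `λ_J` (indexed from `0`) is at most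
`∑_{n≥J} ‖gₙ‖²`, which decays faster than every exponential; as the moments of a function on
`[-R, R]` determine it, `H₀` is injective and its eigenvectors for positive eigenvalues form a
basis.

Writing `K_J` for the Mercer sum `∑_{j<J} v_j(x) v_j(y)`, the truncated functional is the chain
integral of `K_J` against the Chebyshev partial sums of the `φᵢ`. The comparison has two steps.

* Replace `K` by `K_J`, one link of the chain at a time. Both kernels are bounded by `1` on the
  square, by `0 ≤ K ≤ 1` and `K_J(x, x) ≤ K(x, x)`, and every link contains a variable which may be
  integrated first, so a replacement costs at most a multiple of
  `sup_x ‖K(x, ·) - K_J(x, ·)‖₁ ≤ √(2 R λ_J)`.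
* Replace each `φᵢ` by its Chebyshev sum. Cauchy–Schwarz gives `|K_J(x, y)| ≤ r(x) r(y)` with
  `r(x)² = K_J(x, x)`, so the chain product is at most `r(0)² ∏ᵢ r(xᵢ)²`, whose integral is at most
  `K(0, 0) Tr(H₀)^d`. The Chebyshev tail is a sum of `1 / (k (k - 1) ⋯ (k - p))`, which telescopes.
-/

namespace GinzburgLandau

noncomputable section

open InnerProductSpace Filter Topology

section Enumeration

theorem nonempty_orderIso_nat_of_finite_Iic {ι : Type*} [LinearOrder ι] [Infinite ι]
    (h : ∀ i : ι, (Iic i).Finite) : Nonempty (ι ≃o ℕ) := by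
  obtain ⟨m, hm⟩ := (h (Classical.arbitrary ι)).exists_minimal ⟨_, self_mem_Iic⟩
  let _ : LocallyFiniteOrder ι :=
    LocallyFiniteOrder.ofFiniteIcc fun _ b => (h b).subset Icc_subset_Iic_self
  let _ : OrderBot ι :=
    { bot := m
      bot_le := fun i => (le_total m i).elim id fun him => hm.2 (him.trans hm.1) him }
  have : NoMaxOrder ι := ⟨fun a => by
    by_contra! ha
    exact infinite_univ ((h a).subset fun i _ => ha i)⟩
  let _ : SuccOrder ι := LinearLocallyFiniteOrder.succOrder ι
  let _ : PredOrder ι := LinearLocallyFiniteOrder.predOrder ι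
  exact ⟨orderIsoNatOfLinearSuccPredArch⟩

theorem countable_of_finite_superlevel {ι : Type*} {e : ι → ℝ} (hpos : ∀ i, 0 < e i)
    (hfin : ∀ ε > 0, {i | ε ≤ e i}.Finite) : Countable ι := by
  have hcover : (⋃ n : ℕ, {i | 1 / ((n : ℝ) + 1) ≤ e i}) = univ :=
    eq_univ_of_forall fun i => mem_iUnion.2 <|
      (exists_nat_one_div_lt (hpos i)).imp fun _ hn => hn.le
  rw [← countable_univ_iff, ← hcover]
  exact countable_iUnion fun n => (hfin _ (by positivity)).countable

theorem exists_equiv_nat_antitone {ι : Type*} [Infinite ι] {e : ι → ℝ} (hpos : ∀ i, 0 < e i)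
    (hfin : ∀ ε > 0, {i | ε ≤ e i}.Finite) : ∃ σ : ℕ ≃ ι, Antitone (e ∘ σ) := by
  have := countable_of_finite_superlevel hpos hfin
  obtain ⟨c, hc⟩ := exists_injective_nat ι
  -- Ties of `e` are broken by an arbitrary injection into `ℕ`.
  let key : ι → ℝ ×ₗ ℕ := fun i => toLex (-e i, c i)
  have hkey : Function.Injective key := fun i j hij => hc (congrArg (fun z => (ofLex z).2) hij)
  have hanti : ∀ i j, key i ≤ key j → e j ≤ e i := fun i j hij =>
    neg_le_neg_iff.1 ((Prod.Lex.toLex_le_toLex'.1 hij).1)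
  let _ : LinearOrder ι := LinearOrder.lift' key hkey
  obtain ⟨τ⟩ := nonempty_orderIso_nat_of_finite_Iic fun i : ι =>
    (hfin (e i) (hpos i)).subset fun j hj => hanti j i hj
  exact ⟨τ.symm.toEquiv, fun m n hmn => hanti _ _ (τ.symm.monotone hmn)⟩

end Enumeration

section HilbertSpace

variable {𝕜 E ι : Type*} [RCLike 𝕜] [NormedAddCommGroup E] [InnerProductSpace 𝕜 E]

theorem hasSum_norm_inner_sq_of_hasSum_rankOne {g : ι → E} {T : E →L[𝕜] E}
    (hT : HasSum (fun i => rankOne 𝕜 (g i) (g i)) T) (f : E) :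
    HasSum (fun i => ‖inner 𝕜 (g i) f‖ ^ 2) (RCLike.re (inner 𝕜 (T f) f)) := by
  have h := RCLike.hasSum_re 𝕜
    ((hT.mapL (ContinuousLinearMap.apply 𝕜 E f)).mapL (innerSL 𝕜 f))
  rw [inner_re_symm]
  refine h.congr_fun fun i => ?_
  simp only [ContinuousLinearMap.apply_apply, innerSL_apply_apply, rankOne_apply,
    inner_smul_right, inner_mul_symm_re_eq_norm, norm_mul, norm_inner_symm f, sq]

theorem isPositive_of_hasSum_rankOne {g : ι → E} {T : E →L[𝕜] E}
    (hT : HasSum (fun i => rankOne 𝕜 (g i) (g i)) T) : T.IsPositive := by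
  refine ⟨fun x y => ?_, fun f =>
    (hasSum_norm_inner_sq_of_hasSum_rankOne hT f).nonneg fun _ => sq_nonneg _⟩
  have hright : HasSum (fun i => inner 𝕜 x (rankOne 𝕜 (g i) (g i) y)) (inner 𝕜 x (T y)) :=
    (hT.mapL (ContinuousLinearMap.apply 𝕜 E y)).mapL (innerSL 𝕜 x)
  have hleft : HasSum (fun i => inner 𝕜 (rankOne 𝕜 (g i) (g i) x) y) (inner 𝕜 (T x) y) := by
    have h := (hT.mapL (ContinuousLinearMap.apply 𝕜 E x)).mapL (innerSL 𝕜 y)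
    simpa [Function.comp_def, inner_smul_left, mul_comm] using
      h.map (starRingEnd 𝕜) RCLike.continuous_conj
  refine hleft.unique (hright.congr_fun fun i => ?_)
  exact isSymmetric_rankOne_self (g i) x y

theorem isCompactOperator_rankOne (x y : E) : IsCompactOperator (rankOne 𝕜 x y) := by
  have hid : IsCompactOperator (id : 𝕜 → 𝕜) :=
    (isCompactOperator_id_iff_finiteDimensional (𝕜 := 𝕜)).2 inferInstance
  exact (hid.clm_comp (ContinuousLinearMap.toSpanSingleton 𝕜 x)).comp_clm (innerSL 𝕜 y)

theorem isCompactOperator_of_hasSum_rankOne [CompleteSpace E] {g : ι → E} {T : E →L[𝕜] E}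
    (hT : HasSum (fun i => rankOne 𝕜 (g i) (g i)) T) : IsCompactOperator T :=
  isCompactOperator_of_tendsto hT <| Eventually.of_forall fun _ =>
    (compactOperator (RingHom.id 𝕜) E E).sum_mem fun i _ => isCompactOperator_rankOne (g i) (g i)

theorem inner_eigenvector_self {T : E →L[𝕜] E} {b : ι → E} (hb : Orthonormal 𝕜 b) {ev : ι → ℝ}
    (hev : ∀ j, T (b j) = (ev j : 𝕜) • b j) (j : ι) : inner 𝕜 (T (b j)) (b j) = ev j := by
  simp [hev, inner_smul_left, inner_self_eq_norm_sq_to_K, hb.1 j]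

theorem re_inner_sum_smul_eigenvectors {T : E →L[𝕜] E} {b : ι → E} (hb : Orthonormal 𝕜 b)
    {ev : ι → ℝ} (hev : ∀ j, T (b j) = (ev j : 𝕜) • b j) (c : ι → 𝕜) (s : Finset ι) :
    RCLike.re (inner 𝕜 (T (∑ j ∈ s, c j • b j)) (∑ j ∈ s, c j • b j)) =
      ∑ j ∈ s, ev j * ‖c j‖ ^ 2 := by
  have hTf : T (∑ j ∈ s, c j • b j) = ∑ j ∈ s, (c j * ev j) • b j := by simp [hev, smul_smul]
  rw [hTf, hb.inner_sum, map_sum]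
  refine Finset.sum_congr rfl fun j _ => ?_
  rw [map_mul (starRingEnd 𝕜), RCLike.conj_ofReal, mul_right_comm, RCLike.conj_mul, mul_comm,
    RCLike.re_ofReal_mul]
  norm_cast

theorem exists_ne_zero_inner_sum_smul_eq_zero {κ : Type*} [Fintype ι] [Fintype κ] (g : ι → E)
    (b : κ → E) (hcard : Fintype.card ι < Fintype.card κ) :
    ∃ c : κ → 𝕜, c ≠ 0 ∧ ∀ i, inner 𝕜 (g i) (∑ j, c j • b j) = 0 := by
  let L : (κ → 𝕜) →ₗ[𝕜] (ι → 𝕜) :=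
    LinearMap.pi fun i => innerₛₗ 𝕜 (g i) ∘ₗ Fintype.linearCombination 𝕜 b
  obtain ⟨c, hc, hc0⟩ := Submodule.exists_mem_ne_zero_of_ne_bot
    (LinearMap.ker_ne_bot_of_finrank_lt (f := L) (by simpa using hcard))
  exact ⟨c, hc0, fun i => by simpa [L, Fintype.linearCombination_apply] using congrFun hc i⟩

theorem re_inner_le_tsum_mul_norm_sq {g : ℕ → E} {T : E →L[𝕜] E}
    (hT : HasSum (fun n => rankOne 𝕜 (g n) (g n)) T) (hg : Summable fun n => ‖g n‖ ^ 2) {J : ℕ}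
    {f : E} (hf : ∀ n < J, inner 𝕜 (g n) f = 0) :
    RCLike.re (inner 𝕜 (T f) f) ≤ (∑' n, ‖g (n + J)‖ ^ 2) * ‖f‖ ^ 2 := by
  have hs := hasSum_norm_inner_sq_of_hasSum_rankOne hT f
  have hhead : ∑ n ∈ Finset.range J, ‖inner 𝕜 (g n) f‖ ^ 2 = 0 :=
    Finset.sum_eq_zero fun n hn => by simp [hf n (Finset.mem_range.1 hn)]
  rw [← hs.tsum_eq, ← hs.summable.sum_add_tsum_nat_add J, hhead, zero_add, ← tsum_mul_right]
  refine ((summable_nat_add_iff J).2 hs.summable).tsum_le_tsum (fun n => ?_)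
    (((summable_nat_add_iff J).2 hg).mul_right _)
  rw [← mul_pow]
  exact pow_le_pow_left₀ (norm_nonneg _) (norm_inner_le_norm _ _) 2

/- The min-max argument: some unit vector in the span of `b 0, …, b J` is orthogonal to
`g 0, …, g (J - 1)`. -/
theorem eigenvalue_le_tsum_norm_sq {g : ℕ → E} {T : E →L[𝕜] E}
    (hT : HasSum (fun n => rankOne 𝕜 (g n) (g n)) T) (hg : Summable fun n => ‖g n‖ ^ 2)
    {b : ℕ → E} (hb : Orthonormal 𝕜 b) {ev : ℕ → ℝ} (hev : ∀ j, T (b j) = (ev j : 𝕜) • b j)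
    (hanti : Antitone ev) (J : ℕ) : ev J ≤ ∑' n, ‖g (n + J)‖ ^ 2 := by
  have hbJ : Orthonormal 𝕜 fun j : Fin (J + 1) => b j := hb.comp _ Fin.val_injective
  obtain ⟨c, hc, hcg⟩ := exists_ne_zero_inner_sum_smul_eq_zero (𝕜 := 𝕜)
    (fun n : Fin J => g n) (fun j : Fin (J + 1) => b j) (by simp)
  set f : E := ∑ j : Fin (J + 1), c j • b j with hf
  have hnorm : ‖f‖ ^ 2 = ∑ j, ‖c j‖ ^ 2 := by
    rw [← inner_self_eq_norm_sq (𝕜 := 𝕜), hf, hbJ.inner_sum, map_sum]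
    exact Finset.sum_congr rfl fun j _ => by rw [RCLike.conj_mul]; norm_cast
  have hpos : 0 < ‖f‖ ^ 2 := by
    obtain ⟨i, hi⟩ := Function.ne_iff.1 hc
    rw [hnorm]
    exact Finset.sum_pos' (fun _ _ => sq_nonneg _)
      ⟨i, Finset.mem_univ _, pow_pos (norm_pos_iff.2 hi) 2⟩
  have hlow : ev J * ‖f‖ ^ 2 ≤ RCLike.re (inner 𝕜 (T f) f) := by
    rw [re_inner_sum_smul_eigenvectors hbJ (fun j => hev j), hnorm, Finset.mul_sum]
    exact Finset.sum_le_sum fun j _ =>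
      mul_le_mul_of_nonneg_right (hanti (Nat.lt_succ_iff.1 j.2)) (sq_nonneg _)
  exact le_of_mul_le_mul_right
    (hlow.trans (re_inner_le_tsum_mul_norm_sq hT hg fun n hn => hcg ⟨n, hn⟩)) hpos

theorem summable_eigenvalues {g : ι → E} {T : E →L[𝕜] E}
    (hT : HasSum (fun i => rankOne 𝕜 (g i) (g i)) T) (hg : Summable fun i => ‖g i‖ ^ 2)
    {κ : Type*} {b : κ → E} (hb : Orthonormal 𝕜 b) {ev : κ → ℝ}
    (hev : ∀ j, T (b j) = (ev j : 𝕜) • b j) : Summable ev := by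
  have hs : ∀ j, HasSum (fun i => ‖inner 𝕜 (g i) (b j)‖ ^ 2) (ev j) := fun j => by
    simpa only [inner_eigenvector_self hb hev j, RCLike.ofReal_re] using
      hasSum_norm_inner_sq_of_hasSum_rankOne hT (b j)
  refine summable_of_sum_le (c := ∑' i, ‖g i‖ ^ 2)
    (fun j => (hs j).nonneg fun i => sq_nonneg _) fun s => ?_
  refine hasSum_le (fun i => ?_) (hasSum_sum fun j (_ : j ∈ s) => hs j) hg.hasSum
  simpa only [norm_inner_symm (g i)] using hb.sum_inner_products_le (x := g i) (s := s)

theorem mem_orthogonal_of_forall_inner_hilbertBasis {V : Submodule 𝕜 E} (B : HilbertBasis ι 𝕜 V)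
    {f : E} (hf : ∀ i, inner 𝕜 f (B i : E) = 0) : f ∈ Vᗮ := by
  rw [Submodule.mem_orthogonal']
  intro x hx
  have h := ((B.hasSum_repr ⟨x, hx⟩).mapL V.subtypeL).mapL (innerSL 𝕜 f)
  exact h.unique (by simp [hf])

theorem exists_orthonormal_eigenvectors_orthogonal_eq_bot [CompleteSpace E] {T : E →L[𝕜] E}
    (hcpt : IsCompactOperator T) (hsymm : (T : E →ₗ[𝕜] E).IsSymmetric) :
    ∃ w : Set E, Orthonormal 𝕜 (Subtype.val : w → E) ∧ (Submodule.span 𝕜 w)ᗮ = ⊥ ∧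
      ∀ x ∈ w, ∃ μ : ℝ, T x = (μ : 𝕜) • x := by
  let V : 𝕜 → Submodule 𝕜 E := fun μ => Module.End.eigenspace (T : E →ₗ[𝕜] E) μ
  have hVclosed : ∀ μ, IsClosed (V μ : Set E) := fun μ => by
    have hV : (V μ : Set E) = {x | T x = μ • x} := by ext x; simp [V]
    exact hV ▸ isClosed_eq T.continuous (continuous_const_smul μ)
  have : ∀ μ, CompleteSpace (V μ) := fun μ => (hVclosed μ).completeSpace_coe
  choose w B _ using fun μ => exists_hilbertBasis 𝕜 (V μ)
  let v : (Σ μ, w μ) → E := fun a => (B a.1 a.2 : E)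
  have hv : Orthonormal 𝕜 v :=
    hsymm.orthogonalFamily_eigenspaces.orthonormal_sigma_orthonormal fun μ => (B μ).orthonormal
  refine ⟨range v, hv.toSubtypeRange, ?_, ?_⟩
  · rw [eq_bot_iff,
      ← ContinuousLinearMap.orthogonalComplement_iSup_eigenspaces_eq_bot hcpt hsymm,
      ← Submodule.iInf_orthogonal]
    refine fun f hf => Submodule.mem_iInf _ |>.2 fun μ =>
      mem_orthogonal_of_forall_inner_hilbertBasis (B μ) fun i => ?_
    exact (Submodule.mem_orthogonal' _ _).1 hf _ (Submodule.subset_span ⟨⟨μ, i⟩, rfl⟩)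
  · rintro _ ⟨a, rfl⟩
    have heig : Module.End.HasEigenvector (T : E →ₗ[𝕜] E) a.1 (v a) :=
      ⟨(B a.1 a.2).2, hv.ne_zero a⟩
    have hreal := RCLike.conj_eq_iff_re.1
      (hsymm.conj_eigenvalue_eq_self (Module.End.hasEigenvalue_of_hasEigenvector heig))
    exact ⟨RCLike.re a.1, by rw [hreal]; exact heig.apply_eq_smul⟩

theorem infinite_of_orthogonal_span_eq_bot [CompleteSpace E] (hE : ¬ FiniteDimensional 𝕜 E)
    {w : Set E} (hw : (Submodule.span 𝕜 w)ᗮ = ⊥) : Infinite w := by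
  rw [infinite_coe_iff]
  intro hfin
  have := FiniteDimensional.span_of_finite 𝕜 hfin
  rw [Submodule.orthogonal_eq_bot_iff] at hw
  exact hE (Module.finite_def.2 (hw ▸ Submodule.fg_span hfin))

theorem eigenvalue_pos_of_hasSum_rankOne {g : ι → E} {T : E →L[𝕜] E}
    (hT : HasSum (fun i => rankOne 𝕜 (g i) (g i)) T)
    (htotal : ∀ f : E, (∀ i, inner 𝕜 (g i) f = 0) → f = 0) {x : E} (hx : x ≠ 0) {μ : ℝ}
    (hTx : T x = (μ : 𝕜) • x) : 0 < μ := by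
  have hs := hasSum_norm_inner_sq_of_hasSum_rankOne hT x
  have hre : RCLike.re (inner 𝕜 (T x) x) = μ * ‖x‖ ^ 2 := by
    rw [hTx, inner_smul_left, RCLike.conj_ofReal, RCLike.re_ofReal_mul, inner_self_eq_norm_sq]
  rw [hre] at hs
  refine pos_of_mul_pos_left ((hs.nonneg fun _ => sq_nonneg _).lt_of_ne fun h0 => hx ?_)
    (sq_nonneg ‖x‖)
  rw [← h0, hasSum_zero_iff_of_nonneg fun _ => sq_nonneg _] at hs
  exact htotal x fun i => by simpa using congrFun hs i

theorem norm_sub_sum_inner_smul_sq_le (b : HilbertBasis ι 𝕜 E) (x : E) (s : Finset ι) {C : ℝ}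
    (hC : ∀ t : Finset ι, Disjoint t s → ∑ j ∈ t, ‖inner 𝕜 (b j) x‖ ^ 2 ≤ C) :
    ‖x - ∑ j ∈ s, inner 𝕜 (b j) x • b j‖ ^ 2 ≤ C := by
  classical
  set r : E := x - ∑ j ∈ s, inner 𝕜 (b j) x • b j
  have hcoeff : ∀ j, inner 𝕜 (b j) r = if j ∈ s then 0 else inner 𝕜 (b j) x := fun j => by
    simp only [r, inner_sub_right, inner_sum, inner_smul_right,
      orthonormal_iff_ite.1 b.orthonormal]
    split_ifs with hj <;> simp [hj]
  have hparseval : HasSum (fun j => ‖inner 𝕜 (b j) r‖ ^ 2) (‖r‖ ^ 2) := by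
    rw [← inner_self_eq_norm_sq (𝕜 := 𝕜)]
    refine (RCLike.hasSum_re 𝕜 (b.hasSum_inner_mul_inner r r)).congr_fun fun j => ?_
    rw [inner_mul_symm_re_eq_norm, norm_mul, norm_inner_symm, sq]
  refine hasSum_le_of_sum_le hparseval fun t => ?_
  calc ∑ j ∈ t, ‖inner 𝕜 (b j) r‖ ^ 2
      = ∑ j ∈ t \ s, ‖inner 𝕜 (b j) x‖ ^ 2 := by
        rw [Finset.sdiff_eq_filter, Finset.sum_filter]
        exact Finset.sum_congr rfl fun j _ => by rw [hcoeff]; split_ifs <;> simp_all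
    _ ≤ C := hC _ Finset.sdiff_disjoint

theorem exists_hilbertBasis_antitone [CompleteSpace E] {g : ι → E} {T : E →L[𝕜] E}
    (hT : HasSum (fun i => rankOne 𝕜 (g i) (g i)) T) (hg : Summable fun i => ‖g i‖ ^ 2)
    (htotal : ∀ f : E, (∀ i, inner 𝕜 (g i) f = 0) → f = 0) (hE : ¬ FiniteDimensional 𝕜 E) :
    ∃ (b : HilbertBasis ℕ 𝕜 E) (ev : ℕ → ℝ), Antitone ev ∧ (∀ j, 0 < ev j) ∧
      ∀ j, T (b j) = (ev j : 𝕜) • b j := by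
  obtain ⟨w, hw, hbot, hTw⟩ := exists_orthonormal_eigenvectors_orthogonal_eq_bot
    (isCompactOperator_of_hasSum_rankOne hT) (isPositive_of_hasSum_rankOne hT).isSymmetric
  choose ev hev using fun x : w => hTw x x.2
  have hpos : ∀ x, 0 < ev x := fun x =>
    eigenvalue_pos_of_hasSum_rankOne hT htotal (hw.ne_zero x) (hev x)
  have := infinite_of_orthogonal_span_eq_bot hE hbot
  obtain ⟨σ, hσ⟩ := exists_equiv_nat_antitone hpos fun ε hε => by
    have h := (summable_eigenvalues hT hg hw hev).tendsto_cofinite_zero.eventually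
      (gt_mem_nhds hε)
    simpa [eventually_cofinite] using h
  have hwσ : Orthonormal 𝕜 (Subtype.val ∘ σ) := hw.comp _ σ.injective
  refine ⟨HilbertBasis.mkOfOrthogonalEqBot hwσ ?_, _, hσ, fun j => hpos _, fun j => ?_⟩
  · rwa [σ.surjective.range_comp, Subtype.range_coe]
  · simpa using hev (σ j)

end HilbertSpace

section LpSpaces

variable {X : Type*} [MeasurableSpace X] {μ : Measure X}

theorem memLp_restrict_of_continuousOn [TopologicalSpace X] [T2Space X] [OpensMeasurableSpace X]
    [IsFiniteMeasureOnCompacts μ] {K : Set X} (hK : IsCompact K) {f : X → ℝ}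
    (hf : ContinuousOn f K) (p : ℝ≥0∞) : MemLp f p (μ.restrict K) := by
  obtain ⟨C, hC⟩ := hK.exists_bound_of_continuousOn hf
  have := isFiniteMeasure_restrict.2 (hK.measure_lt_top (μ := μ)).ne
  exact MemLp.of_bound (hf.aestronglyMeasurable_of_isCompact hK hK.measurableSet) C
    (ae_restrict_of_forall_mem hK.measurableSet hC)

theorem inner_toLp_left {f : X → ℝ} (hf : MemLp f 2 μ) (k : Lp ℝ 2 μ) :
    inner ℝ (hf.toLp f) k = ∫ y, f y * k y ∂μ := by
  rw [L2.inner_def]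
  refine integral_congr_ae ?_
  filter_upwards [hf.coeFn_toLp] with y hy
  simp [hy, mul_comm]

theorem norm_toLp_sq {f : X → ℝ} (hf : MemLp f 2 μ) : ‖hf.toLp f‖ ^ 2 = ∫ y, f y ^ 2 ∂μ := by
  rw [← real_inner_self_eq_norm_sq, inner_toLp_left]
  refine integral_congr_ae ?_
  filter_upwards [hf.coeFn_toLp] with y hy
  rw [hy, sq]

theorem norm_toLp_sq_le [IsFiniteMeasure μ] {f : X → ℝ} (hf : MemLp f 2 μ) {C : ℝ}
    (hC : ∀ᵐ x ∂μ, f x ^ 2 ≤ C) : ‖hf.toLp f‖ ^ 2 ≤ μ.real univ * C := by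
  rw [norm_toLp_sq, ← smul_eq_mul, ← integral_const]
  exact integral_mono_ae hf.integrable_sq (integrable_const C) hC

theorem ae_eq_of_hasSum_Lp [IsFiniteMeasure μ] {p : ℝ≥0∞} [Fact (1 ≤ p)] {F : ℕ → Lp ℝ p μ}
    {S : Lp ℝ p μ} (hF : HasSum F S) {f : ℕ → X → ℝ} (hFf : ∀ n, F n =ᵐ[μ] f n) {s : X → ℝ}
    (hs : ∀ᵐ x ∂μ, HasSum (fun n => f n x) (s x)) : S =ᵐ[μ] s := by
  have hpartial : ∀ N, ⇑(∑ n ∈ Finset.range N, F n) =ᵐ[μ] fun x => ∑ n ∈ Finset.range N, f n x :=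
    fun N => by
      filter_upwards [Lp.coeFn_finsetSum (Finset.range N) F, ae_all_iff.2 hFf] with x hx hx'
      rw [hx, Finset.sum_apply]
      exact Finset.sum_congr rfl fun n _ => hx' n
  refine tendstoInMeasure_ae_unique (tendstoInMeasure_of_tendsto_Lp hF.tendsto_sum_nat)
    (tendstoInMeasure_of_tendsto_ae (fun N => Lp.aestronglyMeasurable _) ?_)
  filter_upwards [hs, ae_all_iff.2 hpartial] with x hx hx'
  simpa only [hx'] using hx.tendsto_sum_nat

theorem hasSum_rankOne_of_ae_hasSum [IsFiniteMeasure μ] {g : ℕ → X → ℝ}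
    (hg : ∀ n, MemLp (g n) 2 μ) (hsum : Summable fun n => ‖(hg n).toLp (g n)‖ ^ 2)
    {T : Lp ℝ 2 μ →L[ℝ] Lp ℝ 2 μ}
    (hT : ∀ f, ∀ᵐ x ∂μ, HasSum (fun n => g n x * inner ℝ ((hg n).toLp (g n)) f) (T f x)) :
    HasSum (fun n => rankOne ℝ ((hg n).toLp (g n)) ((hg n).toLp (g n))) T := by
  have hs : Summable fun n => rankOne ℝ ((hg n).toLp (g n)) ((hg n).toLp (g n)) :=
    Summable.of_norm (by simpa [← sq] using hsum)
  convert hs.hasSum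
  ext1 f
  refine (Lp.ext (ae_eq_of_hasSum_Lp (hs.hasSum.mapL (ContinuousLinearMap.apply ℝ _ f))
    (fun n => ?_) (hT f))).symm
  filter_upwards [Lp.coeFn_smul (inner ℝ ((hg n).toLp (g n)) f) ((hg n).toLp (g n)),
    (hg n).coeFn_toLp] with x hx hx'
  rw [ContinuousLinearMap.apply_apply, rankOne_apply, hx, Pi.smul_apply, hx', smul_eq_mul, mul_comm]

theorem hasSum_mul_inner_toLp [IsFiniteMeasure μ] {g : ℕ → X → ℝ} (hg : ∀ n, MemLp (g n) 2 μ)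
    {a C : ℕ → ℝ} (hC : Summable C) (hbound : ∀ n, ∀ᵐ y ∂μ, |a n * g n y| ≤ C n) {k : X → ℝ}
    (hk : ∀ᵐ y ∂μ, HasSum (fun n => a n * g n y) (k y)) (f : Lp ℝ 2 μ) :
    HasSum (fun n => a n * inner ℝ ((hg n).toLp (g n)) f) (∫ y, k y * f y ∂μ) := by
  have hf : Integrable (fun y => f y) μ := (Lp.memLp f).integrable one_le_two
  have hterm : ∀ n, a n * inner ℝ ((hg n).toLp (g n)) f = ∫ y, a n * g n y * f y ∂μ := fun n => by
    simp only [inner_toLp_left, ← integral_const_mul, mul_assoc]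
  simp only [hterm]
  refine hasSum_integral_of_dominated_convergence (fun n y => C n * ‖f y‖)
    (fun n => (((hg n).1.const_mul _).mul hf.1)) (fun n => ?_)
    (Eventually.of_forall fun y => hC.mul_right _) ?_ ?_
  · filter_upwards [hbound n] with y hy
    rw [norm_mul]
    exact mul_le_mul_of_nonneg_right hy (norm_nonneg _)
  · simpa only [tsum_mul_right] using hf.norm.const_mul _
  · filter_upwards [hk] with y hy using hy.mul_right _

end LpSpaces

section Interval

theorem not_finiteDimensional_Lp_Icc {a b : ℝ} (hab : a < b) (p : ℝ≥0∞) [Fact (1 ≤ p)] :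
    ¬ FiniteDimensional ℝ (Lp ℝ p (volume.restrict (Icc a b))) := by
  intro hfin
  have hmem : ∀ q : Polynomial ℝ, MemLp (fun x => q.eval x) p (volume.restrict (Icc a b)) :=
    fun q => memLp_restrict_of_continuousOn isCompact_Icc q.continuousOn p
  let L : Polynomial ℝ →ₗ[ℝ] Lp ℝ p (volume.restrict (Icc a b)) :=
    { toFun := fun q => (hmem q).toLp _
      map_add' := fun q r => by
        rw [← MemLp.toLp_add]
        congr 1; ext x; simp
      map_smul' := fun c q => by
        rw [RingHom.id_apply, ← MemLp.toLp_const_smul]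
        congr 1; ext x; simp }
  have hL : Function.Injective L := fun q r hqr => by
    have hae : (fun x => q.eval x) =ᵐ[volume.restrict (Icc a b)] fun x => r.eval x :=
      (MemLp.toLp_eq_toLp_iff (hmem q) (hmem r)).1 hqr
    have heq := Measure.eqOn_Icc_of_ae_eq (volume : Measure ℝ) hab.ne hae
      q.continuousOn r.continuousOn
    exact Polynomial.eq_of_infinite_eval_eq q r ((Icc_infinite hab).mono fun x hx => heq hx)
  exact Polynomial.not_finite (Module.Finite.of_injective L hL)

variable {μ : Measure ℝ} {a b : ℝ} {F : ℝ → ℝ}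

theorem setIntegral_eval_mul_eq_zero (hF : IntegrableOn F (Icc a b) μ)
    (hmom : ∀ n : ℕ, ∫ y in Icc a b, y ^ n * F y ∂μ = 0) (p : Polynomial ℝ) :
    ∫ y in Icc a b, p.eval y * F y ∂μ = 0 := by
  simp only [Polynomial.eval_eq_sum_range, Finset.sum_mul]
  rw [integral_finsetSum _ fun n _ => hF.continuousOn_mul (by fun_prop) isCompact_Icc]
  simp only [mul_assoc, integral_const_mul, hmom, mul_zero, Finset.sum_const_zero]

/- By Weierstrass, `g` is uniformly approximated by polynomials. -/
theorem setIntegral_mul_eq_zero_of_moments (hF : IntegrableOn F (Icc a b) μ)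
    (hmom : ∀ n : ℕ, ∫ y in Icc a b, y ^ n * F y ∂μ = 0) {g : ℝ → ℝ}
    (hg : ContinuousOn g (Icc a b)) : ∫ y in Icc a b, g y * F y ∂μ = 0 := by
  set C := ∫ y in Icc a b, ‖F y‖ ∂μ
  have : 0 ≤ C := integral_nonneg fun _ => norm_nonneg _
  refine norm_le_zero_iff.1 (le_of_forall_pos_le_add fun ε hε => ?_)
  obtain ⟨p, hp⟩ := exists_polynomial_near_of_continuousOn a b g hg (ε / (C + 1)) (by positivity)
  have hdiff : ∫ y in Icc a b, g y * F y ∂μ = ∫ y in Icc a b, (g y - p.eval y) * F y ∂μ := by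
    simp only [sub_mul]
    rw [integral_sub (hF.continuousOn_mul hg isCompact_Icc)
      (hF.continuousOn_mul p.continuousOn isCompact_Icc),
      setIntegral_eval_mul_eq_zero hF hmom, sub_zero]
  calc ‖∫ y in Icc a b, g y * F y ∂μ‖
      ≤ ∫ y in Icc a b, ε / (C + 1) * ‖F y‖ ∂μ := by
        rw [hdiff]
        refine norm_integral_le_of_norm_le (hF.norm.const_mul _) ?_
        filter_upwards [ae_restrict_mem measurableSet_Icc] with y hy
        rw [norm_mul, Real.norm_eq_abs, abs_sub_comm]
        exact mul_le_mul_of_nonneg_right (hp y hy).le (norm_nonneg _)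
    _ = ε * (C / (C + 1)) := by rw [integral_const_mul]; ring
    _ ≤ 0 + ε := by
        rw [zero_add]
        exact mul_le_of_le_one_right hε.le (div_le_one_of_le₀ (by linarith) (by positivity))

theorem ae_eq_zero_of_moments (hF : IntegrableOn F (Icc a b) μ)
    (hmom : ∀ n : ℕ, ∫ y in Icc a b, y ^ n * F y ∂μ = 0) : F =ᵐ[μ.restrict (Icc a b)] 0 :=
  ae_eq_zero_of_integral_contDiff_smul_eq_zero hF.locallyIntegrable fun _ hg _ =>
    setIntegral_mul_eq_zero_of_moments hF hmom hg.continuous.continuousOn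

end Interval

section Features

/-- The factor `w(x) = exp(-(1-x²)²/(8λ) - λx²/(2h²))` splitting off the kernel as
`K(x,y) = w(x) w(y) exp(λxy/h²)`. -/
def weight (lam h x : ℝ) : ℝ :=
  Real.exp (-(1 / (8 * lam)) * (1 - x ^ 2) ^ 2) * Real.exp (-(lam / (2 * h ^ 2)) * x ^ 2)

/-- The functions `gₙ(x) = w(x) √((λ/h²)ⁿ/n!) xⁿ`, for which the power series of `exp(λxy/h²)`
reads `K(x,y) = ∑ₙ gₙ(x) gₙ(y)`. -/
def feature (lam h : ℝ) (n : ℕ) (x : ℝ) : ℝ :=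
  weight lam h x * (√((lam / h ^ 2) ^ n / n.factorial) * x ^ n)

variable {lam h R : ℝ}

theorem continuous_weight (lam h : ℝ) : Continuous (weight lam h) := by
  unfold weight; fun_prop

theorem weight_pos (lam h x : ℝ) : 0 < weight lam h x := by
  unfold weight; positivity

theorem exp_neg_mul_sq_le_one {c : ℝ} (hc : 0 ≤ c) (z : ℝ) : Real.exp (-c * z ^ 2) ≤ 1 :=
  Real.exp_le_one_iff.2 (by nlinarith [sq_nonneg z])

theorem weight_le_one (hlam : 0 ≤ lam) (h x : ℝ) : weight lam h x ≤ 1 :=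
  mul_le_one₀ (exp_neg_mul_sq_le_one (by positivity) _) (Real.exp_pos _).le
    (exp_neg_mul_sq_le_one (by positivity) _)

theorem kernel_eq_weight_mul (lam h x y : ℝ) :
    kernel lam h x y = weight lam h x * weight lam h y * Real.exp (lam / h ^ 2 * (x * y)) := by
  unfold kernel weight
  simp only [← Real.exp_add]
  congr 1
  ring

theorem continuous_feature (lam h : ℝ) (n : ℕ) : Continuous (feature lam h n) :=
  (continuous_weight lam h).mul (by fun_prop)

theorem memLp_feature (lam h R : ℝ) (n : ℕ) : MemLp (feature lam h n) 2 (muI R) :=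
  memLp_restrict_of_continuousOn isCompact_Icc (continuous_feature lam h n).continuousOn 2

/-- The class of `gₙ` in `L²([-R, R])`. -/
def featureLp (lam h R : ℝ) (n : ℕ) : L2I R := (memLp_feature lam h R n).toLp _

theorem feature_mul_feature (hlam : 0 ≤ lam) (n : ℕ) (x y : ℝ) :
    feature lam h n x * feature lam h n y =
      weight lam h x * weight lam h y * ((lam / h ^ 2 * (x * y)) ^ n / n.factorial) := by
  have hsqrt := Real.mul_self_sqrt (show 0 ≤ (lam / h ^ 2) ^ n / n.factorial by positivity)
  rw [mul_pow, mul_pow, mul_div_right_comm, ← hsqrt]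
  unfold feature
  ring

theorem hasSum_feature_mul_feature (hlam : 0 ≤ lam) (x y : ℝ) :
    HasSum (fun n => feature lam h n x * feature lam h n y) (kernel lam h x y) := by
  have hexp := NormedSpace.expSeries_div_hasSum_exp (lam / h ^ 2 * (x * y))
  rw [← Real.exp_eq_exp_ℝ] at hexp
  simpa only [feature_mul_feature hlam, kernel_eq_weight_mul] using
    hexp.mul_left (weight lam h x * weight lam h y)

theorem abs_feature_mul_feature_le (hlam : 0 ≤ lam) {x y : ℝ} (hx : x ∈ Icc (-R) R)
    (hy : y ∈ Icc (-R) R) (n : ℕ) :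
    |feature lam h n x * feature lam h n y| ≤ (lam / h ^ 2 * R ^ 2) ^ n / n.factorial := by
  have hxy : |x * y| ≤ R ^ 2 := by
    rw [abs_mul, sq]
    exact mul_le_mul (abs_le.2 hx) (abs_le.2 hy) (abs_nonneg _) ((abs_nonneg x).trans (abs_le.2 hx))
  have hw : weight lam h x * weight lam h y ≤ 1 :=
    mul_le_one₀ (weight_le_one hlam h x) (weight_pos lam h y).le (weight_le_one hlam h y)
  have hw0 : 0 ≤ weight lam h x * weight lam h y :=
    mul_nonneg (weight_pos lam h x).le (weight_pos lam h y).le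
  have hc : 0 ≤ lam / h ^ 2 := by positivity
  rw [feature_mul_feature hlam, abs_mul, abs_of_nonneg hw0, abs_div, abs_pow, abs_mul,
    abs_of_nonneg hc, Nat.abs_cast]
  refine (mul_le_of_le_one_left (by positivity) hw).trans ?_
  gcongr

theorem feature_sq_le (hlam : 0 ≤ lam) {x : ℝ} (hx : x ∈ Icc (-R) R) (n : ℕ) :
    feature lam h n x ^ 2 ≤ (lam / h ^ 2 * R ^ 2) ^ n / n.factorial := by
  rw [sq]
  exact (le_abs_self _).trans (abs_feature_mul_feature_le hlam hx hx n)

theorem muI_real_univ (hR : 0 ≤ R) : (muI R).real univ = 2 * R := by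
  simp [Measure.real, Real.volume_Icc, hR]
  ring

theorem norm_featureLp_sq_le (hlam : 0 ≤ lam) (hR : 0 ≤ R) (n : ℕ) :
    ‖featureLp lam h R n‖ ^ 2 ≤ 2 * R * ((lam / h ^ 2 * R ^ 2) ^ n / n.factorial) := by
  rw [← muI_real_univ hR]
  exact norm_toLp_sq_le _ (ae_restrict_of_forall_mem measurableSet_Icc
    fun _ hx => feature_sq_le hlam hx n)

theorem summable_norm_featureLp_sq (hlam : 0 ≤ lam) (hR : 0 ≤ R) :
    Summable fun n => ‖featureLp lam h R n‖ ^ 2 :=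
  Summable.of_nonneg_of_le (fun _ => sq_nonneg _) (norm_featureLp_sq_le hlam hR)
    ((Real.summable_pow_div_factorial _).mul_left _)

theorem tsum_pow_div_factorial_tail_le {s α : ℝ} (hs : 0 ≤ s) (hα : 0 ≤ α) (J : ℕ) :
    ∑' n, s ^ (n + J) / (n + J).factorial ≤
      Real.exp (s * Real.exp α) * Real.exp (-(α * J)) := by
  have hexp := (NormedSpace.expSeries_div_hasSum_exp (s * Real.exp α)).mul_right
    (Real.exp (-(α * J)))
  rw [← Real.exp_eq_exp_ℝ] at hexp
  have hterm : ∀ n, s ^ (n + J) / (n + J).factorial ≤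
      (s * Real.exp α) ^ (n + J) / (n + J).factorial * Real.exp (-(α * J)) := fun n => by
    have hone : 1 ≤ Real.exp α ^ (n + J) * Real.exp (-(α * J)) := by
      rw [← Real.exp_nat_mul, ← Real.exp_add]
      refine Real.one_le_exp ?_
      push_cast
      linarith [mul_nonneg (Nat.cast_nonneg (α := ℝ) n) hα]
    rw [mul_pow, mul_div_right_comm, mul_assoc]
    exact le_mul_of_one_le_right (by positivity) hone
  rw [← hexp.tsum_eq, ← hexp.summable.sum_add_tsum_nat_add J]
  refine (((summable_nat_add_iff J).2 (Real.summable_pow_div_factorial s)).tsum_le_tsum hterm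
    ((summable_nat_add_iff J).2 hexp.summable)).trans (le_add_of_nonneg_left ?_)
  exact Finset.sum_nonneg fun n _ => by positivity

theorem tsum_norm_featureLp_sq_le (hlam : 0 ≤ lam) (hR : 0 ≤ R) {α : ℝ} (hα : 0 ≤ α) (J : ℕ) :
    ∑' n, ‖featureLp lam h R (n + J)‖ ^ 2 ≤
      2 * R * Real.exp (lam / h ^ 2 * R ^ 2 * Real.exp α) * Real.exp (-(α * J)) := by
  have hsum : Summable fun n => 2 * R * ((lam / h ^ 2 * R ^ 2) ^ (n + J) / (n + J).factorial) :=
    ((summable_nat_add_iff J).2 (Real.summable_pow_div_factorial _)).mul_left _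
  refine (((summable_nat_add_iff J).2 (summable_norm_featureLp_sq hlam hR)).tsum_le_tsum
    (fun n => norm_featureLp_sq_le hlam hR (n + J)) hsum).trans ?_
  rw [tsum_mul_left, mul_assoc (2 * R)]
  exact mul_le_mul_of_nonneg_left (tsum_pow_div_factorial_tail_le (by positivity) hα J)
    (by positivity)

theorem hasSum_integral_kernel (hlam : 0 ≤ lam) {x : ℝ} (hx : x ∈ Icc (-R) R) (f : L2I R) :
    HasSum (fun n => feature lam h n x * inner ℝ (featureLp lam h R n) f)
      (∫ y, kernel lam h x y * f y ∂(muI R)) :=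
  hasSum_mul_inner_toLp (memLp_feature lam h R) (Real.summable_pow_div_factorial _)
    (fun n => ae_restrict_of_forall_mem measurableSet_Icc
      fun _ hy => abs_feature_mul_feature_le hlam hx hy n)
    (Eventually.of_forall (hasSum_feature_mul_feature hlam x)) f

theorem opH0_ae_eq (f : L2I R) :
    opH0 lam h R f =ᵐ[muI R] fun x => ∫ y, kernel lam h x y * f y ∂(muI R) :=
  (memLp_integral_kernel lam h f).coeFn_toLp

theorem hasSum_rankOne_featureLp (hlam : 0 ≤ lam) (hR : 0 ≤ R) :
    HasSum (fun n => rankOne ℝ (featureLp lam h R n) (featureLp lam h R n)) (opH0 lam h R) := by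
  refine hasSum_rankOne_of_ae_hasSum (memLp_feature lam h R) (summable_norm_featureLp_sq hlam hR)
    fun f => ?_
  filter_upwards [opH0_ae_eq (lam := lam) (h := h) f, ae_restrict_mem measurableSet_Icc]
    with x hx hxR
  rw [hx]
  exact hasSum_integral_kernel hlam hxR f

theorem eq_zero_of_inner_featureLp_eq_zero (hlam : 0 < lam) (hh : h ≠ 0) {f : L2I R}
    (hf : ∀ n, inner ℝ (featureLp lam h R n) f = 0) : f = 0 := by
  have hint : Integrable (fun y => weight lam h y * f y) (muI R) :=
    IntegrableOn.continuousOn_mul (continuous_weight lam h).continuousOn (integrable_L2I f)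
      isCompact_Icc
  have hmom : ∀ n : ℕ, ∫ y, y ^ n * (weight lam h y * f y) ∂(muI R) = 0 := fun n => by
    have hn := hf n
    have hfactor : ∀ y, feature lam h n y * f y =
        √((lam / h ^ 2) ^ n / n.factorial) * (y ^ n * (weight lam h y * f y)) := fun y => by
      unfold feature; ring
    simp only [featureLp, inner_toLp_left, hfactor, integral_const_mul] at hn
    exact (mul_eq_zero.1 hn).resolve_left (Real.sqrt_pos.2 (by positivity)).ne'
  refine Lp.ext ?_
  filter_upwards [ae_eq_zero_of_moments hint hmom, Lp.coeFn_zero ℝ 2 (muI R)] with y hy hy0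
  rw [hy0]
  exact (mul_eq_zero.1 hy).resolve_left (weight_pos lam h y).ne'

theorem kernel_nonneg (lam h x y : ℝ) : 0 ≤ kernel lam h x y := by
  unfold kernel; positivity

theorem kernel_comm (lam h x y : ℝ) : kernel lam h x y = kernel lam h y x := by
  unfold kernel; ring_nf

theorem kernel_le_one (hlam : 0 ≤ lam) (h x y : ℝ) : kernel lam h x y ≤ 1 := by
  have hpotential : ∀ z, Real.exp (-(1 / (8 * lam)) * z ^ 2) ≤ 1 :=
    exp_neg_mul_sq_le_one (by positivity)
  have hinteraction := exp_neg_mul_sq_le_one (c := lam / (2 * h ^ 2)) (by positivity) (x - y)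
  unfold kernel
  exact mul_le_one₀ (mul_le_one₀ (hpotential _) (Real.exp_pos _).le hinteraction)
    (Real.exp_pos _).le (hpotential _)

theorem continuous_kernel_left (lam h x : ℝ) : Continuous (kernel lam h x) := by
  unfold kernel
  fun_prop

theorem memLp_kernel (lam h R x : ℝ) : MemLp (kernel lam h x) 2 (muI R) :=
  memLp_restrict_of_continuousOn isCompact_Icc (continuous_kernel_left lam h x).continuousOn 2

theorem continuous_integral_kernel (hlam : 0 ≤ lam) (h : ℝ) (f : L2I R) :
    Continuous fun x => ∫ y, kernel lam h x y * f y ∂(muI R) := by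
  refine continuous_of_dominated (bound := fun y => ‖f y‖)
    (fun x => (continuous_kernel_left lam h x).aestronglyMeasurable.mul (integrable_L2I f).1)
    (fun x => Eventually.of_forall fun y => ?_) (integrable_L2I f).norm
    (Eventually.of_forall fun y => ?_)
  · rw [norm_mul, Real.norm_of_nonneg (kernel_nonneg _ _ _ _)]
    exact mul_le_of_le_one_left (norm_nonneg _) (kernel_le_one hlam _ _ _)
  · exact ((continuous_kernel lam h).comp (Continuous.prodMk_left y)).mul continuous_const

/- The continuous representatives are `u j = (ev j)⁻¹ ∫ K(·, y) b j(y) dy`. -/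
theorem exists_isEigendecomposition (hlam : 0 < lam) (hh : h ≠ 0) (hR : 0 < R) :
    ∃ (ev : ℕ → ℝ) (u : ℕ → ℝ → ℝ), IsEigendecomposition lam h R ev u := by
  obtain ⟨b, ev, hanti, hpos, hb⟩ := exists_hilbertBasis_antitone
    (hasSum_rankOne_featureLp hlam.le hR.le) (summable_norm_featureLp_sq hlam.le hR.le)
    (fun _ => eq_zero_of_inner_featureLp_eq_zero hlam hh)
    (not_finiteDimensional_Lp_Icc (by linarith) 2)
  refine ⟨ev, fun j x => (ev j)⁻¹ * ∫ y, kernel lam h x y * b j y ∂(muI R), fun j => ?_,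
    fun j => (hpos j).le, hanti, b, fun j => ⟨?_, hb j⟩⟩
  · exact (continuous_const.mul (continuous_integral_kernel hlam.le h _)).continuousOn
  · have hTb := opH0_ae_eq (lam := lam) (h := h) (b j)
    rw [hb j] at hTb
    filter_upwards [hTb, Lp.coeFn_smul (ev j) (b j)] with x hx hx'
    rw [← hx, RCLike.ofReal_real_eq_id, id, hx', Pi.smul_apply, smul_eq_mul,
      inv_mul_cancel_left₀ (hpos j).ne']

end Features

section Mercer

/-- The Mercer expansion `∑_{j<J} v_j(x) v_j(y)` of the kernel truncated to the first `J`
eigenvalues. -/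
def mercerSum (ev : ℕ → ℝ) (u : ℕ → ℝ → ℝ) (J : ℕ) (x y : ℝ) : ℝ :=
  ∑ j ∈ Finset.range J, vFun ev u j x * vFun ev u j y

variable {lam h R : ℝ} {ev : ℕ → ℝ} {u : ℕ → ℝ → ℝ}

theorem mercerSum_comm (ev : ℕ → ℝ) (u : ℕ → ℝ → ℝ) (J : ℕ) (x y : ℝ) :
    mercerSum ev u J x y = mercerSum ev u J y x :=
  Finset.sum_congr rfl fun _ _ => mul_comm _ _

theorem mercerSum_self_nonneg (ev : ℕ → ℝ) (u : ℕ → ℝ → ℝ) (J : ℕ) (x : ℝ) :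
    0 ≤ mercerSum ev u J x x :=
  Finset.sum_nonneg fun _ _ => mul_self_nonneg _

theorem abs_mercerSum_le (ev : ℕ → ℝ) (u : ℕ → ℝ → ℝ) (J : ℕ) (x y : ℝ) :
    |mercerSum ev u J x y| ≤ √(mercerSum ev u J x x) * √(mercerSum ev u J y y) := by
  rw [← Real.sqrt_mul (mercerSum_self_nonneg ev u J x)]
  refine Real.abs_le_sqrt ?_
  simpa only [mercerSum, ← sq] using Finset.sum_mul_sq_le_sq_mul_sq (Finset.range J)
    (fun j => vFun ev u j x) fun j => vFun ev u j y

theorem vFun_mul_vFun (hev : ∀ j, 0 ≤ ev j) (j : ℕ) (x y : ℝ) :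
    vFun ev u j x * vFun ev u j y = ev j * u j x * u j y := by
  unfold vFun
  linear_combination u j x * u j y * Real.mul_self_sqrt (hev j)

theorem IsEigendecomposition.continuousOn_vFun (hu : IsEigendecomposition lam h R ev u) (j : ℕ) :
    ContinuousOn (vFun ev u j) (Icc (-R) R) :=
  continuousOn_const.mul (hu.continuousOn j)

theorem continuousOn_mercerSum (hu : IsEigendecomposition lam h R ev u) (J : ℕ) :
    ContinuousOn (Function.uncurry (mercerSum ev u J)) (Icc (-R) R ×ˢ Icc (-R) R) := by
  have hprod : ∀ j, ContinuousOn (fun z : ℝ × ℝ => vFun ev u j z.1 * vFun ev u j z.2)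
      (Icc (-R) R ×ˢ Icc (-R) R) := fun j =>
    ((hu.continuousOn_vFun j).comp continuousOn_fst fun _ hz => hz.1).mul
      ((hu.continuousOn_vFun j).comp continuousOn_snd fun _ hz => hz.2)
  exact continuousOn_finsetSum (Finset.range J) fun j _ => hprod j

theorem IsEigendecomposition.summable (hu : IsEigendecomposition lam h R ev u) (hlam : 0 ≤ lam)
    (hR : 0 ≤ R) : Summable ev := by
  obtain ⟨b, hb⟩ := hu.basis
  exact summable_eigenvalues (hasSum_rankOne_featureLp hlam hR)
    (summable_norm_featureLp_sq hlam hR) b.orthonormal fun j => (hb j).2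

theorem IsEigendecomposition.le_exp (hu : IsEigendecomposition lam h R ev u) (hlam : 0 ≤ lam)
    (hR : 0 ≤ R) {α : ℝ} (hα : 0 ≤ α) (J : ℕ) :
    ev J ≤ 2 * R * Real.exp (lam / h ^ 2 * R ^ 2 * Real.exp α) * Real.exp (-(α * J)) := by
  obtain ⟨b, hb⟩ := hu.basis
  exact (eigenvalue_le_tsum_norm_sq (hasSum_rankOne_featureLp hlam hR)
    (summable_norm_featureLp_sq hlam hR) b.orthonormal (fun j => (hb j).2) hu.antitone J).trans
      (tsum_norm_featureLp_sq_le hlam hR hα J)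

theorem integral_kernel_mul_eigenvector (hlam : 0 ≤ lam) (hR : 0 < R) {b : L2I R} {c : ℝ}
    {f : ℝ → ℝ} (hf : ContinuousOn f (Icc (-R) R)) (hbf : b =ᵐ[muI R] f)
    (hb : opH0 lam h R b = c • b) {x : ℝ} (hx : x ∈ Icc (-R) R) :
    ∫ y, kernel lam h x y * b y ∂(muI R) = c * f x := by
  have hae : (fun x => ∫ y, kernel lam h x y * b y ∂(muI R)) =ᵐ[muI R] fun x => c * f x := by
    have hHb := opH0_ae_eq (lam := lam) (h := h) b
    rw [hb] at hHb
    filter_upwards [hHb, Lp.coeFn_smul c b, hbf] with x hx hx' hx''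
    rw [← hx, hx', Pi.smul_apply, smul_eq_mul, hx'']
  exact Measure.eqOn_Icc_of_ae_eq volume (by linarith : -R ≠ R) hae
    (continuous_integral_kernel hlam h b).continuousOn (continuousOn_const.mul hf) hx

theorem le_of_hasSum_sq_of_hasSum_mul {p q : ℕ → ℝ} {A B : ℝ} (hp : HasSum (fun n => p n ^ 2) A)
    (hq : HasSum (fun n => q n ^ 2) B) (hpq : HasSum (fun n => p n * q n) B) : B ≤ A := by
  have hsq := ((hp.sub (hpq.mul_left 2)).add hq).nonneg fun n => by
    linarith [sq_nonneg (p n - q n), sub_sq (p n) (q n)]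
  linarith

/- With `f = ∑ u_j(x) b_j`, both `⟪H₀ f, f⟫ = ∑ₙ ⟪gₙ, f⟫²` and `∑ₙ gₙ(x) ⟪gₙ, f⟫` equal the left
side, while `K(x,x) = ∑ₙ gₙ(x)²`. -/
theorem sum_eigenvalue_mul_sq_le_kernel (hu : IsEigendecomposition lam h R ev u) (hlam : 0 ≤ lam)
    (hR : 0 < R) (s : Finset ℕ) {x : ℝ} (hx : x ∈ Icc (-R) R) :
    ∑ j ∈ s, ev j * u j x ^ 2 ≤ kernel lam h x x := by
  obtain ⟨b, hb⟩ := hu.basis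
  set f : L2I R := ∑ j ∈ s, u j x • b j with hf
  have hdiag : HasSum (fun n => feature lam h n x ^ 2) (kernel lam h x x) := by
    simpa only [sq] using hasSum_feature_mul_feature hlam x x
  have hquad : HasSum (fun n => inner ℝ (featureLp lam h R n) f ^ 2)
      (∑ j ∈ s, ev j * u j x ^ 2) := by
    have hform := re_inner_sum_smul_eigenvectors b.orthonormal (fun j => (hb j).2)
      (fun j => u j x) s
    simp only [← hf, Real.norm_eq_abs, sq_abs] at hform
    simpa only [hform, Real.norm_eq_abs, sq_abs] using
      hasSum_norm_inner_sq_of_hasSum_rankOne (hasSum_rankOne_featureLp (h := h) hlam hR.le) f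
  have hmixed : HasSum (fun n => feature lam h n x * inner ℝ (featureLp lam h R n) f)
      (∑ j ∈ s, ev j * u j x ^ 2) := by
    have hsum := hasSum_sum (s := s) fun j _ =>
      (hasSum_integral_kernel (h := h) hlam hx (b j)).mul_left (u j x)
    simp only [integral_kernel_mul_eigenvector hlam hR (hu.continuousOn _) (hb _).1 (hb _).2 hx]
      at hsum
    have hterm : ∀ n, feature lam h n x * inner ℝ (featureLp lam h R n) f =
        ∑ j ∈ s, u j x * (feature lam h n x * inner ℝ (featureLp lam h R n) (b j)) := fun n => by
      simp only [hf, inner_sum, inner_smul_right, Finset.mul_sum, mul_left_comm]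
    have hvalue : ∑ j ∈ s, ev j * u j x ^ 2 = ∑ j ∈ s, u j x * (ev j * u j x) :=
      Finset.sum_congr rfl fun j _ => by ring
    simpa only [hterm, hvalue] using hsum
  exact le_of_hasSum_sq_of_hasSum_mul hdiag hquad hmixed

theorem mercerSum_self_le_kernel (hu : IsEigendecomposition lam h R ev u) (hlam : 0 ≤ lam)
    (hR : 0 < R) (J : ℕ) {x : ℝ} (hx : x ∈ Icc (-R) R) :
    mercerSum ev u J x x ≤ kernel lam h x x := by
  refine le_trans (le_of_eq ?_) (sum_eigenvalue_mul_sq_le_kernel hu hlam hR (Finset.range J) hx)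
  exact Finset.sum_congr rfl fun j _ => by rw [vFun_mul_vFun hu.nonneg]; ring

theorem abs_mercerSum_le_one (hu : IsEigendecomposition lam h R ev u) (hlam : 0 ≤ lam)
    (hR : 0 < R) (J : ℕ) {x y : ℝ} (hx : x ∈ Icc (-R) R) (hy : y ∈ Icc (-R) R) :
    |mercerSum ev u J x y| ≤ 1 := by
  have hsqrt : ∀ z ∈ Icc (-R) R, √(mercerSum ev u J z z) ≤ 1 := fun z hz =>
    Real.sqrt_le_one.2 ((mercerSum_self_le_kernel hu hlam hR J hz).trans (kernel_le_one hlam _ _ _))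
  exact (abs_mercerSum_le ev u J x y).trans
    (mul_le_one₀ (hsqrt x hx) (Real.sqrt_nonneg _) (hsqrt y hy))

theorem integral_vFun_mul_self (hu : IsEigendecomposition lam h R ev u) (j : ℕ) :
    ∫ x, vFun ev u j x * vFun ev u j x ∂(muI R) = ev j := by
  obtain ⟨b, hb⟩ := hu.basis
  have hnorm : ∫ x, u j x * u j x ∂(muI R) = 1 := by
    have hunit : inner ℝ (b j) (b j) = (1 : ℝ) := by
      rw [real_inner_self_eq_norm_sq, b.orthonormal.1 j, one_pow]
    rw [← hunit, L2.inner_def]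
    refine integral_congr_ae ?_
    filter_upwards [(hb j).1] with x hx
    simp [hx, sq]
  simp only [vFun_mul_vFun hu.nonneg, mul_assoc, integral_const_mul, hnorm, mul_one]

theorem integral_mercerSum_self_le (hu : IsEigendecomposition lam h R ev u) (hlam : 0 ≤ lam)
    (hR : 0 ≤ R) (J : ℕ) : ∫ x, mercerSum ev u J x x ∂(muI R) ≤ ∑' j, ev j := by
  have hint : ∀ j, Integrable (fun x => vFun ev u j x * vFun ev u j x) (muI R) := fun j =>
    ((hu.continuousOn_vFun j).mul (hu.continuousOn_vFun j)).integrableOn_Icc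
  unfold mercerSum
  rw [integral_finsetSum _ fun j _ => hint j]
  simp only [integral_vFun_mul_self hu]
  exact (hu.summable hlam hR).sum_le_tsum _ fun j _ => hu.nonneg j

theorem norm_kernel_sub_mercerSum_sq_le (hu : IsEigendecomposition lam h R ev u) (hlam : 0 ≤ lam)
    (b : HilbertBasis ℕ ℝ (L2I R)) (hR : 0 < R) {x : ℝ} (hx : x ∈ Icc (-R) R)
    (hinner : ∀ j, inner ℝ (b j) ((memLp_kernel lam h R x).toLp _) = ev j * u j x) (J : ℕ) :
    ‖(memLp_kernel lam h R x).toLp _ - ∑ j ∈ Finset.range J, (ev j * u j x) • b j‖ ^ 2 ≤ ev J := by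
  simp only [← hinner]
  refine norm_sub_sum_inner_smul_sq_le b _ _ fun t ht => ?_
  calc ∑ j ∈ t, ‖inner ℝ (b j) ((memLp_kernel lam h R x).toLp _)‖ ^ 2
      ≤ ∑ j ∈ t, ev J * (ev j * u j x ^ 2) := Finset.sum_le_sum fun j hj => by
        have hJj : J ≤ j := by simpa using Finset.disjoint_left.1 ht hj
        rw [hinner, Real.norm_eq_abs, sq_abs, mul_pow, sq (ev j), mul_assoc]
        exact mul_le_mul_of_nonneg_right (hu.antitone hJj)
          (mul_nonneg (hu.nonneg j) (sq_nonneg _))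
    _ = ev J * ∑ j ∈ t, ev j * u j x ^ 2 := (Finset.mul_sum _ _ _).symm
    _ ≤ ev J := mul_le_of_le_one_right (hu.nonneg J)
        ((sum_eigenvalue_mul_sq_le_kernel hu hlam hR t hx).trans (kernel_le_one hlam _ _ _))

theorem integral_abs_kernel_sub_mercerSum_le (hu : IsEigendecomposition lam h R ev u)
    (hlam : 0 ≤ lam) (hR : 0 < R) (J : ℕ) {x : ℝ} (hx : x ∈ Icc (-R) R) :
    ∫ y, |kernel lam h x y - mercerSum ev u J x y| ∂(muI R) ≤ √(2 * R * ev J) := by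
  obtain ⟨b, hb⟩ := hu.basis
  set k : L2I R := (memLp_kernel lam h R x).toLp _
  have hinner : ∀ j, inner ℝ (b j) k = ev j * u j x := fun j => by
    rw [real_inner_comm, inner_toLp_left,
      integral_kernel_mul_eigenvector hlam hR (hu.continuousOn j) (hb j).1 (hb j).2 hx]
  set r : L2I R := k - ∑ j ∈ Finset.range J, (ev j * u j x) • b j
  have hterm : ∀ᵐ y ∂(muI R), ∀ j : ℕ, ((ev j * u j x) • b j : L2I R) y =
      vFun ev u j x * vFun ev u j y := ae_all_iff.2 fun j => by
    filter_upwards [Lp.coeFn_smul (ev j * u j x) (b j), (hb j).1] with y hy hy'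
    rw [hy, Pi.smul_apply, smul_eq_mul, hy', vFun_mul_vFun hu.nonneg]
  have hr : ∀ᵐ y ∂(muI R), |kernel lam h x y - mercerSum ev u J x y| = ‖r y‖ := by
    filter_upwards [Lp.coeFn_sub k (∑ j ∈ Finset.range J, (ev j * u j x) • b j), hterm,
      (memLp_kernel lam h R x).coeFn_toLp,
      Lp.coeFn_finsetSum (Finset.range J) fun j => ((ev j * u j x) • b j : L2I R)]
      with y hsub hterm hk hsum
    rw [hsub, Pi.sub_apply, hk, hsum, Finset.sum_apply, Real.norm_eq_abs]
    simp only [hterm, mercerSum]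
  have hmass : ((muI R) univ ^ (1 / 2 : ℝ)).toReal = √(2 * R) := by
    rw [← ENNReal.toReal_rpow, ← Real.sqrt_eq_rpow, ← muI_real_univ hR.le, Measure.real]
  calc ∫ y, |kernel lam h x y - mercerSum ev u J x y| ∂(muI R)
      = ∫ y, ‖r y‖ ∂(muI R) := integral_congr_ae hr
    _ ≤ ‖r‖ * √(2 * R) := hmass ▸ integral_norm_le r
    _ ≤ √(ev J) * √(2 * R) := mul_le_mul_of_nonneg_right
        (Real.le_sqrt_of_sq_le (norm_kernel_sub_mercerSum_sq_le hu hlam b hR hx hinner J))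
        (Real.sqrt_nonneg _)
    _ = √(2 * R * ev J) := by rw [mul_comm, Real.sqrt_mul (x := 2 * R) (by positivity)]

end Mercer

section CosineSeries

open Real

/-- The unnormalised cosine coefficient `∫_0^π g(θ) cos(nθ) dθ` of an even `2π`-periodic `g`. -/
def cosIntegral (g : ℝ → ℝ) (n : ℕ) : ℝ := ∫ θ in (0 : ℝ)..π, g θ * cos (n * θ)

theorem integral_neg_self_eq_integral_add {E : Type*} [NormedAddCommGroup E] [NormedSpace ℝ E]
    {g : ℝ → E} {a : ℝ} (hg : IntervalIntegrable g volume 0 a)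
    (hg' : IntervalIntegrable g volume (-a) 0) :
    ∫ t in (-a)..a, g t = ∫ t in (0 : ℝ)..a, (g (-t) + g t) := by
  have hneg : IntervalIntegrable (fun t => g (-t)) volume 0 a := by
    simpa using ((IntervalIntegrable.iff_comp_neg (f := g) (a := -a) (b := 0)).1 hg').symm
  rw [← intervalIntegral.integral_add_adjacent_intervals hg' hg,
    intervalIntegral.integral_add hneg hg, intervalIntegral.integral_comp_neg, neg_zero]

theorem fourierCoeff_eq_cosIntegral [Fact (0 < 2 * π)] {F : AddCircle (2 * π) → ℂ} {g : ℝ → ℝ}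
    (hg : Continuous g) (heven : g.Even) (hF : ∀ θ : ℝ, F θ = g θ) (n : ℤ) :
    fourierCoeff F n = (1 / π * cosIntegral g n.natAbs : ℝ) := by
  have hchar : ∀ t : ℝ, fourier (-n) (t : AddCircle (2 * π)) =
      Complex.exp (-(n * t) * Complex.I) := fun t => by
    rw [fourier_coe_apply]
    congr 1
    push_cast
    field_simp
  have hcont : Continuous fun t : ℝ => Complex.exp (-(n * t) * Complex.I) * (g t : ℂ) := by
    fun_prop
  have hfold : ∀ t : ℝ, Complex.exp (-(n * (-t : ℝ)) * Complex.I) * (g (-t) : ℂ) +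
      Complex.exp (-(n * t) * Complex.I) * (g t : ℂ) =
        ((2 * (g t * cos (n.natAbs * t)) : ℝ) : ℂ) := fun t => by
    have habs : cos (n.natAbs * t) = cos (n * t) := by
      rw [Nat.cast_natAbs, Int.cast_abs]
      rcases abs_choice (n : ℝ) with h | h <;> simp [h]
    have htwo := Complex.two_cos (n * t)
    rw [habs, heven t]
    push_cast
    rw [mul_neg, neg_neg, ← add_mul, ← htwo]
    ring
  rw [fourierCoeff_eq_intervalIntegral F n (-π), show -π + 2 * π = π by ring]
  simp only [hF, hchar, smul_eq_mul]
  rw [integral_neg_self_eq_integral_add (hcont.intervalIntegrable _ _)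
    (hcont.intervalIntegrable _ _)]
  simp only [hfold]
  rw [intervalIntegral.integral_ofReal, intervalIntegral.integral_const_mul, ← cosIntegral,
    Complex.real_smul, ← Complex.ofReal_mul]
  congr 1
  field_simp

theorem hasSum_cosIntegral_mul_cos {g : ℝ → ℝ} (hg : Continuous g) (heven : g.Even)
    (hper : g.Periodic (2 * π)) (hs : Summable (cosIntegral g)) (θ : ℝ) :
    HasSum (fun n : ℕ => (if n = 0 then 1 else 2) / π * cosIntegral g n * cos (n * θ)) (g θ) := by
  have : Fact (0 < 2 * π) := ⟨two_pi_pos⟩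
  let F : C(AddCircle (2 * π), ℂ) :=
    ⟨(hper.comp Complex.ofReal).lift,
      continuous_coinduced_dom.2 (Complex.continuous_ofReal.comp hg)⟩
  have hF : ∀ t : ℝ, F t = g t := fun _ => rfl
  have hcoeff := fourierCoeff_eq_cosIntegral hg heven hF
  have hsum : Summable (fourierCoeff F) := by
    refine Summable.of_nat_of_neg ?_ ?_ <;>
    · simp only [hcoeff, Int.natAbs_neg, Int.natAbs_natCast]
      exact Complex.summable_ofReal.2 (hs.mul_left _)
  have hseries :=
    (has_pointwise_sum_fourier_series_of_summable hsum (θ : AddCircle (2 * π))).nat_add_neg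
  have hpair := hseries.sub (hasSum_ite_eq 0 (fourierCoeff F 0 • fourier 0 (θ : AddCircle (2 * π))))
  rw [add_sub_cancel_right, hF] at hpair
  rw [← Complex.hasSum_ofReal]
  refine hpair.congr_fun fun n => ?_
  have hchar : fourier (n : ℤ) (θ : AddCircle (2 * π)) + fourier (-n : ℤ) (θ : AddCircle (2 * π)) =
      2 * Complex.cos (n * θ) := by
    rw [Complex.two_cos, fourier_coe_apply, fourier_coe_apply]
    push_cast
    congr 2 <;> field_simp
  simp only [hcoeff, Int.natAbs_neg, Int.natAbs_natCast, smul_eq_mul]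
  rw [← mul_add, hchar]
  split_ifs with hn
  · subst hn; simp; ring
  · push_cast; ring

end CosineSeries

section CosineDecay

open Real

variable {f : ℝ → ℝ}

theorem continuous_comp_cos (hf : ContinuousOn f (Icc (-1) 1)) : Continuous (f ∘ cos) :=
  hf.comp_continuous continuous_cos cos_mem_Icc

theorem continuousOn_derivWithin_Icc (hf : ContDiffOn ℝ 1 f (Icc (-1) 1)) :
    ContinuousOn (derivWithin f (Icc (-1) 1)) (Icc (-1) 1) :=
  hf.continuousOn_derivWithin (uniqueDiffOn_Icc (by norm_num)) le_rfl

theorem hasDerivAt_comp_cos (hf : DifferentiableOn ℝ f (Icc (-1) 1)) {θ : ℝ}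
    (hθ : θ ∈ Ioo 0 π) :
    HasDerivAt (f ∘ cos) (derivWithin f (Icc (-1) 1) (cos θ) * (-sin θ)) θ := by
  have hmem : cos θ ∈ Ioo (-1 : ℝ) 1 := by
    have hsin := sin_pos_of_mem_Ioo hθ
    have hsq := sin_sq_add_cos_sq θ
    constructor <;> nlinarith
  exact ((hf _ (Ioo_subset_Icc_self hmem)).hasDerivWithinAt.hasDerivAt
    (Icc_mem_nhds hmem.1 hmem.2)).comp θ (hasDerivAt_cos θ)

theorem cosIntegral_comp_cos_eq_integral_derivWithin (hf : ContDiffOn ℝ 1 f (Icc (-1) 1)) {k : ℕ}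
    (hk : k ≠ 0) : cosIntegral (f ∘ cos) k =
      1 / k * ∫ θ in (0 : ℝ)..π, derivWithin f (Icc (-1) 1) (cos θ) * sin θ * sin (k * θ) := by
  have hk' : (k : ℝ) ≠ 0 := Nat.cast_ne_zero.2 hk
  have hparts := intervalIntegral.integral_mul_deriv_eq_deriv_mul_of_hasDerivAt (a := 0) (b := π)
    (u := f ∘ cos) (v := fun θ => sin (k * θ) / k)
    (u' := fun θ => derivWithin f (Icc (-1) 1) (cos θ) * (-sin θ)) (v' := fun θ => cos (k * θ))
    (continuous_comp_cos hf.continuousOn).continuousOn (by fun_prop)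
    (fun θ hθ => hasDerivAt_comp_cos (hf.differentiableOn one_ne_zero)
      (by rwa [min_eq_left pi_pos.le, max_eq_right pi_pos.le] at hθ))
    (fun θ _ => by simpa [hk'] using ((hasDerivAt_id θ).const_mul (k : ℝ)).sin.div_const (k : ℝ))
    (((continuous_comp_cos (continuousOn_derivWithin_Icc hf)).mul
      continuous_sin.neg).intervalIntegrable _ _)
    (Continuous.intervalIntegrable (by fun_prop) _ _)
  rw [cosIntegral, hparts, ← intervalIntegral.integral_const_mul]
  simp only [sin_nat_mul_pi, mul_zero, sin_zero, zero_div, sub_self, zero_sub]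
  rw [← intervalIntegral.integral_neg]
  refine intervalIntegral.integral_congr fun θ _ => ?_
  field_simp

theorem cosIntegral_comp_cos_succ (hf : ContDiffOn ℝ 1 f (Icc (-1) 1)) (k : ℕ) :
    cosIntegral (f ∘ cos) (k + 1) =
      (cosIntegral (derivWithin f (Icc (-1) 1) ∘ cos) k -
        cosIntegral (derivWithin f (Icc (-1) 1) ∘ cos) (k + 2)) / 2 / (k + 1 : ℕ) := by
  have hint : ∀ m : ℕ, IntervalIntegrable
      (fun θ => (derivWithin f (Icc (-1) 1) ∘ cos) θ * cos (m * θ)) volume 0 π := fun m =>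
    ((continuous_comp_cos (continuousOn_derivWithin_Icc hf)).mul
      (by fun_prop)).intervalIntegrable _ _
  rw [cosIntegral_comp_cos_eq_integral_derivWithin hf k.succ_ne_zero, cosIntegral, cosIntegral,
    ← intervalIntegral.integral_sub (hint _) (hint _), ← intervalIntegral.integral_div,
    one_div_mul_eq_div]
  congr 1
  refine intervalIntegral.integral_congr fun θ _ => ?_
  have hpred : cos (k * θ) = cos ((k + 1 : ℕ) * θ - θ) := by push_cast; ring_nf
  have hsucc : cos ((k + 2 : ℕ) * θ) = cos ((k + 1 : ℕ) * θ + θ) := by push_cast; ring_nf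
  rw [hpred, hsucc, cos_sub, cos_add, Function.comp_apply]
  ring

theorem integral_comp_cos_mul_sin (hf : ContinuousOn f (Icc (-1) 1)) :
    ∫ θ in (0 : ℝ)..π, f (cos θ) * sin θ = ∫ t in (-1 : ℝ)..1, f t := by
  have hsubst : ∫ θ in (0 : ℝ)..π, f (cos θ) * (-sin θ) = ∫ t in cos 0..cos π, f t :=
    intervalIntegral.integral_comp_mul_deriv' (fun θ _ => hasDerivAt_cos θ)
      continuous_sin.neg.continuousOn
      (hf.mono (image_subset_iff.2 fun θ _ => cos_mem_Icc θ))
  rw [cos_zero, cos_pi, intervalIntegral.integral_symm (-1) 1] at hsubst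
  simpa only [mul_neg, intervalIntegral.integral_neg, neg_inj] using hsubst

theorem abs_cosIntegral_comp_cos_le (hf : ContDiffOn ℝ 1 f (Icc (-1) 1)) {k : ℕ} (hk : k ≠ 0) :
    |cosIntegral (f ∘ cos) k| ≤ (∫ t in (-1 : ℝ)..1, |derivWithin f (Icc (-1) 1) t|) / k := by
  have hf' := continuousOn_derivWithin_Icc hf
  rw [cosIntegral_comp_cos_eq_integral_derivWithin hf hk, ← integral_comp_cos_mul_sin hf'.abs,
    abs_mul, abs_of_nonneg (by positivity), one_div, div_eq_inv_mul]
  refine mul_le_mul_of_nonneg_left ?_ (by positivity)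
  rw [← Real.norm_eq_abs]
  refine intervalIntegral.norm_integral_le_of_norm_le (μ := volume) pi_pos.le
    (Eventually.of_forall fun θ hθ => ?_)
    ((continuous_comp_cos hf'.abs).mul continuous_sin |>.intervalIntegrable _ _)
  have hsin := sin_nonneg_of_nonneg_of_le_pi hθ.1.le hθ.2
  rw [norm_mul, norm_mul, Real.norm_eq_abs, Real.norm_of_nonneg hsin]
  exact mul_le_of_le_one_right (mul_nonneg (abs_nonneg _) hsin) (abs_sin_le_one _)

theorem abs_cosIntegral_comp_cos_le_descFactorial (p : ℕ) {f : ℝ → ℝ}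
    (hf : ContDiffOn ℝ ((p + 1 : ℕ) : WithTop ℕ∞) f (Icc (-1) 1)) {k : ℕ} (hk : p + 1 ≤ k) :
    |cosIntegral (f ∘ cos) k| ≤
      (∫ t in (-1 : ℝ)..1, |iteratedDerivWithin (p + 1) f (Icc (-1) 1) t|) /
        k.descFactorial (p + 1) := by
  induction p generalizing f k with
  | zero =>
    simp only [iteratedDerivWithin_succ', iteratedDerivWithin_zero, zero_add,
      Nat.descFactorial_one]
    exact abs_cosIntegral_comp_cos_le (by simpa using hf) (by omega)
  | succ p ih =>
    obtain ⟨k, rfl⟩ : ∃ m, k = m + 1 := ⟨k - 1, by omega⟩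
    rw [iteratedDerivWithin_succ']
    set f' := derivWithin f (Icc (-1) 1)
    set V := ∫ t in (-1 : ℝ)..1, |iteratedDerivWithin (p + 1) f' (Icc (-1) 1) t|
    have hV : 0 ≤ V := intervalIntegral.integral_nonneg (by norm_num) fun _ _ => abs_nonneg _
    have hf' : ContDiffOn ℝ ((p + 1 : ℕ) : WithTop ℕ∞) f' (Icc (-1) 1) :=
      hf.derivWithin (uniqueDiffOn_Icc (by norm_num)) (by norm_cast)
    have hpos : 0 < k.descFactorial (p + 1) := Nat.descFactorial_pos.2 (by omega)
    have hmono : V / (k + 2).descFactorial (p + 1) ≤ V / k.descFactorial (p + 1) := by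
      gcongr
      omega
    rw [cosIntegral_comp_cos_succ (hf.of_le (by norm_cast; omega)), abs_div, Nat.abs_cast,
      Nat.succ_descFactorial_succ, Nat.cast_mul, div_mul_eq_div_div_swap]
    gcongr
    rw [abs_div, abs_two, div_le_iff₀ two_pos]
    linarith [abs_sub (cosIntegral (f' ∘ cos) k) (cosIntegral (f' ∘ cos) (k + 2)),
      ih hf' (k := k) (by omega), ih hf' (k := k + 2) (by omega)]

theorem inv_descFactorial_sub_inv_descFactorial_succ {p n : ℕ} (hpn : p ≤ n) :
    (1 : ℝ) / n.descFactorial p - 1 / (n + 1).descFactorial p =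
      p / (n + 1).descFactorial (p + 1) := by
  have hn : (0 : ℝ) < n.descFactorial p := by exact_mod_cast Nat.descFactorial_pos.2 hpn
  have hn1 : (0 : ℝ) < (n + 1).descFactorial p := by
    exact_mod_cast Nat.descFactorial_pos.2 (by omega)
  have hshift : ((n : ℝ) + 1 - p) * (n + 1).descFactorial p = (n + 1) * n.descFactorial p := by
    have hnat := congrArg (Nat.cast (R := ℝ)) (Nat.succ_descFactorial n p)
    rw [Nat.cast_mul, Nat.cast_mul, Nat.cast_sub (by omega)] at hnat
    exact_mod_cast hnat
  rw [Nat.succ_descFactorial_succ, Nat.cast_mul]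
  push_cast
  field_simp
  linarith

theorem sub_pow_le_descFactorial {p N : ℕ} (hpN : p ≤ N) :
    ((N : ℝ) - p) ^ p ≤ N.descFactorial p := by
  rw [← Nat.cast_sub hpN]
  exact_mod_cast (Nat.pow_le_pow_left (by omega) p).trans (Nat.pow_sub_le_descFactorial N p)

theorem sum_range_inv_descFactorial_le {p N : ℕ} (hp : p ≠ 0) (hpN : p < N) (m : ℕ) :
    ∑ n ∈ Finset.range m, (1 : ℝ) / (n + (N + 1)).descFactorial (p + 1) ≤
      1 / (p * ((N : ℝ) - p) ^ p) := by
  have hp' : (p : ℝ) ≠ 0 := Nat.cast_ne_zero.2 hp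
  have hterm : ∀ n : ℕ, (1 : ℝ) / (n + (N + 1)).descFactorial (p + 1) =
      1 / p * (1 / (n + N).descFactorial p - 1 / (n + 1 + N).descFactorial p) := fun n => by
    rw [add_right_comm n 1 N, inv_descFactorial_sub_inv_descFactorial_succ (by omega)]
    field_simp
    rfl
  have hNp : (0 : ℝ) < N - p := sub_pos.2 (Nat.cast_lt.2 hpN)
  simp only [hterm]
  rw [← Finset.mul_sum, Finset.sum_range_sub' (fun n => (1 : ℝ) / (n + N).descFactorial p),
    zero_add, ← one_div_mul_one_div]
  refine mul_le_mul_of_nonneg_left ((sub_le_self _ (by positivity)).trans ?_) (by positivity)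
  gcongr
  exact sub_pow_le_descFactorial hpN.le

end CosineDecay

section Chebyshev

variable {R : ℝ} {f : ℝ → ℝ}

/-- The number `‖d^{p+1}/dt^{p+1} f(R t)‖_{L¹([-1,1])}` controlling the Chebyshev coefficients of
`f`; `Vp` is the maximum of these over a family of functions. -/
def derivL1Norm (R : ℝ) (p : ℕ) (f : ℝ → ℝ) : ℝ :=
  ∫ t in (-1 : ℝ)..1, |iteratedDerivWithin (p + 1) (fun s => f (R * s)) (Icc (-1) 1) t|

/-- The Chebyshev expansion of `f` on `[-R, R]` truncated after the term of degree `N`. -/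
def chebSum (R : ℝ) (f : ℝ → ℝ) (N : ℕ) (x : ℝ) : ℝ :=
  ∑ n ∈ Finset.range (N + 1), chebCoeff R f n * chebT R n x

theorem derivL1Norm_nonneg (R : ℝ) (p : ℕ) (f : ℝ → ℝ) : 0 ≤ derivL1Norm R p f :=
  intervalIntegral.integral_nonneg (by norm_num) fun _ _ => abs_nonneg _

theorem chebCoeff_eq_cosIntegral (R : ℝ) (f : ℝ → ℝ) (n : ℕ) :
    chebCoeff R f n =
      (if n = 0 then 1 else 2) / Real.pi * cosIntegral ((fun s => f (R * s)) ∘ Real.cos) n := rfl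

theorem mapsTo_mul_Icc (hR : 0 ≤ R) : MapsTo (fun s => R * s) (Icc (-1) 1) (Icc (-R) R) :=
  fun s hs => ⟨by nlinarith [hs.1], by nlinarith [hs.2]⟩

theorem abs_div_le_one_of_mem_Icc {x : ℝ} (hx : x ∈ Icc (-R) R) : |x / R| ≤ 1 := by
  rw [abs_div]
  exact div_le_one_of_le₀ ((abs_le.2 hx).trans (le_abs_self R)) (abs_nonneg R)

theorem abs_chebT_le_one (n : ℕ) {x : ℝ} (hx : x ∈ Icc (-R) R) : |chebT R n x| ≤ 1 :=
  Polynomial.Chebyshev.abs_eval_T_real_le_one n (abs_div_le_one_of_mem_Icc hx)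

theorem chebT_eq_cos (n : ℕ) {x : ℝ} (hx : x ∈ Icc (-R) R) :
    chebT R n x = Real.cos (n * Real.arccos (x / R)) := by
  obtain ⟨hleft, hright⟩ := abs_le.1 (abs_div_le_one_of_mem_Icc hx)
  rw [chebT, ← Int.cast_natCast (R := ℝ), ← Polynomial.Chebyshev.T_real_cos,
    Real.cos_arccos hleft hright]

theorem continuous_chebT (R : ℝ) (n : ℕ) : Continuous (chebT R n) :=
  (Polynomial.continuous _).comp (continuous_id.div_const R)

theorem continuous_chebSum (R : ℝ) (f : ℝ → ℝ) (N : ℕ) : Continuous (chebSum R f N) :=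
  continuous_finsetSum _ fun n _ => continuous_const.mul (continuous_chebT R n)

theorem hasSum_chebCoeff (hf : ContinuousOn f (Icc (-R) R))
    (hs : Summable fun n => |chebCoeff R f n|) {x : ℝ} (hx : x ∈ Icc (-R) R) :
    HasSum (fun n => chebCoeff R f n * chebT R n x) (f x) := by
  have hR : 0 ≤ R := by linarith [hx.1, hx.2]
  obtain ⟨hleft, hright⟩ := abs_le.1 (abs_div_le_one_of_mem_Icc hx)
  have hscale : R * (x / R) = x :=
    mul_div_cancel_of_imp' fun h0 => by subst h0; exact le_antisymm hx.2 (by simpa using hx.1)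
  have hs' : Summable (cosIntegral ((fun s => f (R * s)) ∘ Real.cos)) := by
    refine Summable.of_norm_bounded (hs.mul_left Real.pi) fun n => ?_
    rw [chebCoeff_eq_cosIntegral, abs_mul, ← mul_assoc, Real.norm_eq_abs]
    refine le_mul_of_one_le_left (abs_nonneg _) ?_
    rw [abs_of_nonneg (by positivity), mul_div_cancel₀ _ Real.pi_ne_zero]
    split_ifs <;> norm_num
  have hseries := hasSum_cosIntegral_mul_cos (g := (fun s => f (R * s)) ∘ Real.cos)
    (continuous_comp_cos (hf.comp (by fun_prop) (mapsTo_mul_Icc hR)))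
    (fun θ => congrArg (fun s => f (R * s)) (Real.cos_neg θ))
    (Real.cos_periodic.comp fun s => f (R * s)) hs' (Real.arccos (x / R))
  simpa only [Function.comp_apply, Real.cos_arccos hleft hright, hscale,
    ← chebCoeff_eq_cosIntegral, ← chebT_eq_cos _ hx] using hseries

theorem abs_chebCoeff_le (hR : 0 ≤ R) {p : ℕ}
    (hf : ContDiffOn ℝ ((p + 1 : ℕ) : WithTop ℕ∞) f (Icc (-R) R)) {k : ℕ} (hk : p + 1 ≤ k) :
    |chebCoeff R f k| ≤
      2 / Real.pi * derivL1Norm R p f * (1 / k.descFactorial (p + 1)) := by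
  rw [chebCoeff_eq_cosIntegral, if_neg (by omega), abs_mul, abs_of_nonneg (by positivity),
    mul_assoc, mul_one_div]
  exact mul_le_mul_of_nonneg_left (abs_cosIntegral_comp_cos_le_descFactorial p
    (hf.comp (contDiff_const.mul contDiff_id).contDiffOn (mapsTo_mul_Icc hR)) hk) (by positivity)

variable {p N : ℕ}

theorem sum_range_abs_chebCoeff_le (hR : 0 ≤ R) (hp : p ≠ 0) (hpN : p < N)
    (hf : ContDiffOn ℝ ((p + 1 : ℕ) : WithTop ℕ∞) f (Icc (-R) R)) (m : ℕ) :
    ∑ n ∈ Finset.range m, |chebCoeff R f (n + (N + 1))| ≤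
      2 * derivL1Norm R p f / (Real.pi * p * ((N : ℝ) - p) ^ p) := by
  have hV := derivL1Norm_nonneg R p f
  calc ∑ n ∈ Finset.range m, |chebCoeff R f (n + (N + 1))|
      ≤ ∑ n ∈ Finset.range m, 2 / Real.pi * derivL1Norm R p f *
          (1 / (n + (N + 1)).descFactorial (p + 1)) :=
        Finset.sum_le_sum fun n _ => abs_chebCoeff_le hR hf (by omega)
    _ ≤ 2 / Real.pi * derivL1Norm R p f * (1 / (p * ((N : ℝ) - p) ^ p)) := by
        rw [← Finset.mul_sum]
        exact mul_le_mul_of_nonneg_left (sum_range_inv_descFactorial_le hp hpN m) (by positivity)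
    _ = 2 * derivL1Norm R p f / (Real.pi * p * ((N : ℝ) - p) ^ p) := by
        rw [mul_one_div, div_mul_eq_mul_div, div_div, mul_assoc Real.pi]

theorem summable_abs_chebCoeff (hR : 0 ≤ R) (hp : p ≠ 0)
    (hf : ContDiffOn ℝ ((p + 1 : ℕ) : WithTop ℕ∞) f (Icc (-R) R)) :
    Summable fun n => |chebCoeff R f n| :=
  (summable_nat_add_iff (p + 1 + 1)).1 (summable_of_sum_range_le (fun _ => abs_nonneg _)
    (sum_range_abs_chebCoeff_le hR hp p.lt_succ_self hf))

theorem abs_sub_chebSum_le (hp : p ≠ 0) (hpN : p < N)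
    (hf : ContDiffOn ℝ ((p + 1 : ℕ) : WithTop ℕ∞) f (Icc (-R) R)) {x : ℝ}
    (hx : x ∈ Icc (-R) R) :
    |f x - chebSum R f N x| ≤ 2 * derivL1Norm R p f / (Real.pi * p * ((N : ℝ) - p) ^ p) := by
  have hR : 0 ≤ R := by linarith [hx.1, hx.2]
  have hs := summable_abs_chebCoeff hR hp hf
  have htail := (hasSum_nat_add_iff' (N + 1)).2 (hasSum_chebCoeff hf.continuousOn hs hx)
  have hs_tail := (summable_nat_add_iff (N + 1)).2 hs
  rw [chebSum, ← htail.tsum_eq, ← Real.norm_eq_abs]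
  refine (tsum_of_norm_bounded hs_tail.hasSum fun n => ?_).trans
    (hs_tail.tsum_le_of_sum_range_le (sum_range_abs_chebCoeff_le hR hp hpN hf))
  rw [norm_mul]
  exact mul_le_of_le_one_right (abs_nonneg _) (abs_chebT_le_one _ hx)

end Chebyshev

section Products

variable {ι : Type*}

theorem abs_prod_sub_prod_le {a b : ι → ℝ} {A : ℝ} (s : Finset ι) (ha : ∀ i ∈ s, |a i| ≤ A)
    (hb : ∀ i ∈ s, |b i| ≤ A) :
    |∏ i ∈ s, a i - ∏ i ∈ s, b i| ≤ A ^ (s.card - 1) * ∑ i ∈ s, |a i - b i| := by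
  classical
  induction s using Finset.induction_on with
  | empty => simp
  | insert i s hi ih =>
    rw [Finset.forall_mem_insert] at ha hb
    have hA : 0 ≤ A := (abs_nonneg _).trans ha.1
    have hprod : |∏ j ∈ s, a j| ≤ A ^ s.card := by
      rw [Finset.abs_prod, ← Finset.prod_const]
      exact Finset.prod_le_prod (fun _ _ => abs_nonneg _) ha.2
    have hpow : A * (A ^ (s.card - 1) * ∑ j ∈ s, |a j - b j|) =
        A ^ s.card * ∑ j ∈ s, |a j - b j| := by
      rcases s.eq_empty_or_nonempty with rfl | hs
      · simp
      · rw [← mul_assoc, mul_pow_sub_one hs.card_pos.ne']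
    rw [Finset.prod_insert hi, Finset.prod_insert hi, Finset.sum_insert hi,
      Finset.card_insert_of_notMem hi, Nat.add_sub_cancel]
    calc |a i * ∏ j ∈ s, a j - b i * ∏ j ∈ s, b j|
        = |(a i - b i) * ∏ j ∈ s, a j + b i * (∏ j ∈ s, a j - ∏ j ∈ s, b j)| := by ring_nf
      _ ≤ |a i - b i| * |∏ j ∈ s, a j| + |b i| * |∏ j ∈ s, a j - ∏ j ∈ s, b j| := by
        rw [← abs_mul, ← abs_mul]
        exact abs_add_le _ _
      _ ≤ |a i - b i| * A ^ s.card + A * (A ^ (s.card - 1) * ∑ j ∈ s, |a j - b j|) := by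
        gcongr
        exacts [hb.1, ih ha.2 hb.2]
      _ = A ^ s.card * (|a i - b i| + ∑ j ∈ s, |a j - b j|) := by rw [hpow]; ring

end Products

section Chain

variable {d : ℕ}

@[simp] theorem chain_zero (x : Fin d → ℝ) : chain x 0 = 0 := rfl

@[simp] theorem chain_succ_castSucc (x : Fin d → ℝ) (i : Fin d) :
    chain x i.succ.castSucc = x i := by
  rw [← Fin.succ_castSucc, chain, Fin.cons_succ, Fin.snoc_castSucc]

@[simp] theorem chain_castSucc_succ (x : Fin d → ℝ) (i : Fin d) :
    chain x i.castSucc.succ = x i := by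
  rw [chain, Fin.cons_succ, Fin.snoc_castSucc]

@[simp] theorem chain_last (x : Fin d → ℝ) : chain x (Fin.last (d + 1)) = 0 := by
  rw [← Fin.succ_last, chain, Fin.cons_succ, Fin.snoc_last]

theorem continuous_chain (l : Fin (d + 2)) : Continuous fun x : Fin d → ℝ => chain x l := by
  have hsnoc : Continuous fun x : Fin d → ℝ => (Fin.snoc x 0 : Fin (d + 1) → ℝ) :=
    Continuous.finSnoc (A := fun _ => ℝ) continuous_id continuous_const
  exact (continuous_apply l).comp (continuous_const.finCons hsnoc)

theorem prod_chain_castSucc (r : Fin (d + 1) → ℝ → ℝ) (x : Fin d → ℝ) :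
    ∏ m : Fin (d + 1), r m (chain x m.castSucc) = r 0 0 * ∏ i : Fin d, r i.succ (x i) := by
  rw [Fin.prod_univ_succ]; simp

theorem prod_chain_succ (r : Fin (d + 1) → ℝ → ℝ) (x : Fin d → ℝ) :
    ∏ m : Fin (d + 1), r m (chain x m.succ) =
      (∏ i : Fin d, r i.castSucc (x i)) * r (Fin.last d) 0 := by
  rw [Fin.prod_univ_castSucc]; simp

theorem exists_chain_insertNth {n : ℕ} {D : ℝ → ℝ → ℝ} (hD : ∀ x y, D x y = D y x)
    (m : Fin (n + 2)) : ∃ (i : Fin (n + 1)) (l : Fin (n + 2)), ∀ (t : ℝ) (y : Fin n → ℝ),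
      D (chain (i.insertNth t y) m.castSucc) (chain (i.insertNth t y) m.succ) =
        D (chain y l) t := by
  induction m using Fin.lastCases with
  | last =>
    refine ⟨Fin.last n, 0, fun t y => ?_⟩
    rw [Fin.succ_last, chain_last, ← Fin.succ_last, chain_succ_castSucc, Fin.insertNth_apply_same,
      hD, chain_zero]
  | cast i =>
    refine ⟨i, i.castSucc, fun t y => ?_⟩
    rw [chain_castSucc_succ, Fin.insertNth_apply_same]
    congr 1
    induction i using Fin.cases with
    | zero => rfl
    | succ j =>
      rw [← Fin.succ_castSucc, chain_succ_castSucc, chain_castSucc_succ,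
        ← Fin.succAbove_of_castSucc_lt j.succ j (Fin.castSucc_lt_succ),
        Fin.insertNth_apply_succAbove]

end Chain

section ChainIntegral

variable {d : ℕ} {s : Set ℝ} {k k' : ℝ → ℝ → ℝ} {ψ ψ' : Fin d → ℝ → ℝ}

/-- The product `k(0, x_1) k(x_1, x_2) ⋯ k(x_d, 0)` of the kernel `k` along the links of the
chain. -/
def chainProd (k : ℝ → ℝ → ℝ) (x : Fin d → ℝ) : ℝ :=
  ∏ m : Fin (d + 1), k (chain x m.castSucc) (chain x m.succ)

/-- The chain integral `∫_{s^d} k(0, x_1) k(x_1, x_2) ⋯ k(x_d, 0) ψ_1(x_1) ⋯ ψ_d(x_d) dx`. Up to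
the factor `cLam`, both `funcH` and `funcHTrunc` are of this form. -/
def chainIntegral (s : Set ℝ) (k : ℝ → ℝ → ℝ) (ψ : Fin d → ℝ → ℝ) : ℝ :=
  ∫ x in univ.pi fun _ : Fin d => s, chainProd k x * ∏ i, ψ i (x i)

theorem restrict_univ_pi (s : Set ℝ) :
    (volume : Measure (Fin d → ℝ)).restrict (univ.pi fun _ => s) =
      Measure.pi fun _ => volume.restrict s := by
  rw [volume_pi, Measure.restrict_pi_pi]

theorem integral_pi_le_of_integral_insertNth_le {n : ℕ} {X : Type*} [MeasurableSpace X]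
    {μ : Measure X} [IsFiniteMeasure μ] (i : Fin (n + 1)) {G : (Fin (n + 1) → X) → ℝ}
    (hG : Integrable G (Measure.pi fun _ => μ)) {δ : ℝ}
    (h : ∀ᵐ y ∂Measure.pi fun _ : Fin n => μ, ∫ t, G (i.insertNth t y) ∂μ ≤ δ) :
    ∫ x, G x ∂(Measure.pi fun _ => μ) ≤ μ.real univ ^ n * δ := by
  have hmp := (measurePreserving_piFinSuccAbove (fun _ : Fin (n + 1) => μ) i).symm
  have hG' := hmp.integrable_comp_of_integrable hG
  rw [← hmp.integral_comp' G]
  refine (integral_prod_symm _ hG').trans_le ?_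
  refine (integral_mono_ae hG'.integral_prod_right (integrable_const δ) h).trans_eq ?_
  rw [integral_const, smul_eq_mul, Measure.real, Measure.pi_univ, Finset.prod_const,
    Finset.card_univ, Fintype.card_fin, ENNReal.toReal_pow, Measure.real]

theorem continuousOn_comp_eval {f : ℝ → ℝ} (hf : ContinuousOn f s) (i : Fin d) :
    ContinuousOn (fun x : Fin d → ℝ => f (x i)) (univ.pi fun _ => s) :=
  hf.comp (continuous_apply i).continuousOn fun _ hx => hx i (mem_univ i)

section

variable (hs : IsCompact s) (h0 : (0 : ℝ) ∈ s)
include h0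

theorem chain_mem {x : Fin d → ℝ} (hx : x ∈ univ.pi fun _ => s) (l : Fin (d + 2)) :
    chain x l ∈ s := by
  induction l using Fin.cases with
  | zero => exact h0
  | succ l =>
    induction l using Fin.lastCases with
    | last => rwa [Fin.succ_last, chain_last]
    | cast i => rw [chain_castSucc_succ]; exact hx i (mem_univ i)

theorem continuousOn_link (hk : ContinuousOn (Function.uncurry k) (s ×ˢ s)) (m : Fin (d + 1)) :
    ContinuousOn (fun x : Fin d → ℝ => k (chain x m.castSucc) (chain x m.succ))
      (univ.pi fun _ => s) :=
  hk.comp (f := fun x => (chain x m.castSucc, chain x m.succ))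
    ((continuous_chain _).prodMk (continuous_chain _)).continuousOn
    fun _ hx => ⟨chain_mem h0 hx m.castSucc, chain_mem h0 hx m.succ⟩

theorem abs_chainProd_sub_le {A : ℝ} (hkA : ∀ x ∈ s, ∀ y ∈ s, |k x y| ≤ A)
    (hkA' : ∀ x ∈ s, ∀ y ∈ s, |k' x y| ≤ A) {x : Fin d → ℝ} (hx : x ∈ univ.pi fun _ => s) :
    |chainProd k x - chainProd k' x| ≤ A ^ d * ∑ m : Fin (d + 1),
      |k (chain x m.castSucc) (chain x m.succ) - k' (chain x m.castSucc) (chain x m.succ)| := by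
  have hprod := abs_prod_sub_prod_le (A := A) Finset.univ
    (fun (m : Fin (d + 1)) _ => hkA _ (chain_mem h0 hx m.castSucc) _ (chain_mem h0 hx m.succ))
    (fun m _ => hkA' _ (chain_mem h0 hx m.castSucc) _ (chain_mem h0 hx m.succ))
  rwa [Finset.card_univ, Fintype.card_fin] at hprod

theorem abs_chainProd_le {r : ℝ → ℝ} (hkr : ∀ x ∈ s, ∀ y ∈ s, |k x y| ≤ r x * r y)
    {x : Fin d → ℝ} (hx : x ∈ univ.pi fun _ => s) :
    |chainProd k x| ≤ r 0 ^ 2 * ∏ i, r (x i) ^ 2 := by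
  rw [chainProd, Finset.abs_prod]
  refine (Finset.prod_le_prod (fun _ _ => abs_nonneg _) fun m _ =>
    hkr _ (chain_mem h0 hx _) _ (chain_mem h0 hx _)).trans_eq ?_
  rw [Finset.prod_mul_distrib, prod_chain_castSucc fun _ => r, prod_chain_succ fun _ => r,
    Finset.prod_pow]
  ring

include hs

theorem integrableOn_abs_link (hk : ContinuousOn (Function.uncurry k) (s ×ˢ s)) (m : Fin (d + 1)) :
    IntegrableOn (fun x : Fin d → ℝ => |k (chain x m.castSucc) (chain x m.succ)|)
      (univ.pi fun _ => s) :=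
  (continuousOn_link h0 hk m).abs.integrableOn_compact (isCompact_univ_pi fun _ => hs)

theorem integrableOn_chainProd_mul (hk : ContinuousOn (Function.uncurry k) (s ×ˢ s))
    (hψ : ∀ i, ContinuousOn (ψ i) s) :
    IntegrableOn (fun x => chainProd k x * ∏ i, ψ i (x i)) (univ.pi fun _ => s) :=
  ((continuousOn_finsetProd _ fun m _ => continuousOn_link h0 hk m).mul
    (continuousOn_finsetProd _ fun i _ => continuousOn_comp_eval (hψ i) i)).integrableOn_compact
      (isCompact_univ_pi fun _ => hs)

theorem integral_abs_link_le {n : ℕ} (hk : ContinuousOn (Function.uncurry k) (s ×ˢ s))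
    (hsymm : ∀ x y, k x y = k y x) {δ : ℝ} (hδ : ∀ x ∈ s, ∫ t in s, |k x t| ≤ δ)
    (m : Fin (n + 2)) :
    ∫ x in univ.pi fun _ : Fin (n + 1) => s, |k (chain x m.castSucc) (chain x m.succ)| ≤
      volume.real s ^ n * δ := by
  have : IsFiniteMeasure (volume.restrict s) := ⟨by simpa using hs.measure_lt_top⟩
  obtain ⟨i, l, hil⟩ := exists_chain_insertNth hsymm m
  have hint := integrableOn_abs_link hs h0 hk m
  rw [IntegrableOn, restrict_univ_pi] at hint
  rw [restrict_univ_pi, ← measureReal_restrict_apply_univ]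
  refine integral_pi_le_of_integral_insertNth_le i hint ?_
  rw [← restrict_univ_pi]
  filter_upwards [ae_restrict_mem (MeasurableSet.univ_pi fun _ => hs.measurableSet)] with y hy
  simpa only [hil] using hδ _ (chain_mem h0 hy l)

theorem abs_chainIntegral_sub_kernel_le {n : ℕ} {ψ : Fin (n + 1) → ℝ → ℝ}
    (hk : ContinuousOn (Function.uncurry k) (s ×ˢ s))
    (hk' : ContinuousOn (Function.uncurry k') (s ×ˢ s)) (hψ : ∀ i, ContinuousOn (ψ i) s)
    (hsymm : ∀ x y, k x y = k y x) (hsymm' : ∀ x y, k' x y = k' y x) {A δ : ℝ}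
    (hkA : ∀ x ∈ s, ∀ y ∈ s, |k x y| ≤ A) (hkA' : ∀ x ∈ s, ∀ y ∈ s, |k' x y| ≤ A)
    (hδ : ∀ x ∈ s, ∫ t in s, |k x t - k' x t| ≤ δ) {B : Fin (n + 1) → ℝ}
    (hB : ∀ i, ∀ x ∈ s, |ψ i x| ≤ B i) :
    |chainIntegral s k ψ - chainIntegral s k' ψ| ≤
      A ^ (n + 1) * ((n + 2) * (volume.real s ^ n * δ)) * ∏ i, B i := by
  have hD : ContinuousOn (Function.uncurry fun x y => k x y - k' x y) (s ×ˢ s) := hk.sub hk'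
  have hA : 0 ≤ A := (abs_nonneg _).trans (hkA 0 h0 0 h0)
  have hpointwise : ∀ x ∈ univ.pi fun _ : Fin (n + 1) => s,
      ‖chainProd k x * ∏ i, ψ i (x i) - chainProd k' x * ∏ i, ψ i (x i)‖ ≤
        A ^ (n + 1) * (∑ m : Fin (n + 2), |k (chain x m.castSucc) (chain x m.succ) -
          k' (chain x m.castSucc) (chain x m.succ)|) * ∏ i, B i := fun x hx => by
    rw [← sub_mul, norm_mul, Real.norm_eq_abs, Real.norm_eq_abs, Finset.abs_prod]
    exact mul_le_mul (abs_chainProd_sub_le h0 hkA hkA' hx)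
      (Finset.prod_le_prod (fun _ _ => abs_nonneg _) fun i _ => hB i _ (hx i (mem_univ i)))
      (Finset.prod_nonneg fun _ _ => abs_nonneg _) (by positivity)
  rw [chainIntegral, chainIntegral, ← integral_sub (integrableOn_chainProd_mul hs h0 hk hψ)
    (integrableOn_chainProd_mul hs h0 hk' hψ), ← Real.norm_eq_abs]
  refine (norm_integral_le_of_norm_le
    (((integrable_finsetSum _ fun m _ => integrableOn_abs_link hs h0 hD m).const_mul _).mul_const _)
    ((ae_restrict_iff' (MeasurableSet.univ_pi fun _ => hs.measurableSet)).2
      (Eventually.of_forall hpointwise))).trans ?_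
  rw [integral_mul_const, integral_const_mul,
    integral_finsetSum _ fun m _ => integrableOn_abs_link hs h0 hD m]
  gcongr
  · exact Finset.prod_nonneg fun i _ => (abs_nonneg _).trans (hB i 0 h0)
  · refine (Finset.sum_le_card_nsmul _ _ _ fun m _ => integral_abs_link_le hs h0 hD
      (fun x y => by rw [hsymm, hsymm']) hδ m).trans_eq ?_
    rw [Finset.card_univ, Fintype.card_fin, nsmul_eq_mul]
    push_cast
    rfl

theorem abs_chainIntegral_sub_factor_le (hk : ContinuousOn (Function.uncurry k) (s ×ˢ s))
    {r : ℝ → ℝ} (hr : ContinuousOn r s) (hkr : ∀ x ∈ s, ∀ y ∈ s, |k x y| ≤ r x * r y)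
    (hψ : ∀ i, ContinuousOn (ψ i) s) (hψ' : ∀ i, ContinuousOn (ψ' i) s) {A ε : ℝ} (hA : 0 ≤ A)
    (hψA : ∀ i, ∀ x ∈ s, |ψ i x| ≤ A) (hψA' : ∀ i, ∀ x ∈ s, |ψ' i x| ≤ A)
    (hε : ∀ i, ∀ x ∈ s, |ψ i x - ψ' i x| ≤ ε) :
    |chainIntegral s k ψ - chainIntegral s k ψ'| ≤
      A ^ (d - 1) * (d * ε) * (r 0 ^ 2 * (∫ x in s, r x ^ 2) ^ d) := by
  have hpointwise : ∀ x ∈ univ.pi fun _ : Fin d => s,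
      ‖chainProd k x * ∏ i, ψ i (x i) - chainProd k x * ∏ i, ψ' i (x i)‖ ≤
        A ^ (d - 1) * (d * ε) * (r 0 ^ 2 * ∏ i, r (x i) ^ 2) := fun x hx => by
    have hxs : ∀ i, x i ∈ s := fun i => hx i (mem_univ i)
    have hsum : ∑ i, |ψ i (x i) - ψ' i (x i)| ≤ d * ε := by
      simpa using Finset.sum_le_card_nsmul Finset.univ _ ε fun i _ => hε i _ (hxs i)
    have hprod := abs_prod_sub_prod_le Finset.univ (fun i _ => hψA i _ (hxs i))
      fun i _ => hψA' i _ (hxs i)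
    rw [Finset.card_univ, Fintype.card_fin] at hprod
    rw [← mul_sub, norm_mul, Real.norm_eq_abs, Real.norm_eq_abs, mul_comm]
    exact mul_le_mul (hprod.trans (by gcongr)) (abs_chainProd_le h0 hkr hx) (abs_nonneg _)
      (mul_nonneg (by positivity) ((Finset.sum_nonneg fun _ _ => abs_nonneg _).trans hsum))
  have hr_int : IntegrableOn (fun x : Fin d → ℝ => ∏ i, r (x i) ^ 2) (univ.pi fun _ => s) :=
    (continuousOn_finsetProd _ fun i _ => (continuousOn_comp_eval hr i).pow 2).integrableOn_compact
      (isCompact_univ_pi fun _ => hs)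
  rw [chainIntegral, chainIntegral, ← integral_sub (integrableOn_chainProd_mul hs h0 hk hψ)
    (integrableOn_chainProd_mul hs h0 hk hψ'), ← Real.norm_eq_abs]
  refine (norm_integral_le_of_norm_le ((hr_int.const_mul _).const_mul _)
    ((ae_restrict_iff' (MeasurableSet.univ_pi fun _ => hs.measurableSet)).2
      (Eventually.of_forall hpointwise))).trans_eq ?_
  rw [integral_const_mul, integral_const_mul, restrict_univ_pi,
    integral_fintype_prod_eq_pow (fun x => r x ^ 2), Fintype.card_fin]

end

end ChainIntegral

section Truncation

variable {d : ℕ} {lam h R : ℝ} {ev : ℕ → ℝ} {u : ℕ → ℝ → ℝ}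

theorem coefA_eq_integral_muI (hR : 0 ≤ R) (ev : ℕ → ℝ) (u : ℕ → ℝ → ℝ) (j l : ℕ) (f : ℝ → ℝ) :
    coefA R ev u j l f = ∫ x, vFun ev u j x * vFun ev u l x * f x ∂(muI R) := by
  rw [coefA, intervalIntegral.integral_of_le (by linarith), integral_Icc_eq_integral_Ioc]

theorem chainProd_mercerSum (ev : ℕ → ℝ) (u : ℕ → ℝ → ℝ) (J : ℕ) (x : Fin d → ℝ) :
    chainProd (mercerSum ev u J) x = ∑ j : Fin (d + 1) → Fin J,
      vFun ev u (j 0) 0 *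
        (∏ i : Fin d, vFun ev u (j i.castSucc) (x i) * vFun ev u (j i.succ) (x i)) *
        vFun ev u (j (Fin.last d)) 0 := by
  simp only [chainProd, mercerSum, Finset.sum_range]
  rw [Finset.prod_univ_sum, Fintype.piFinset_univ]
  refine Finset.sum_congr rfl fun j _ => ?_
  rw [Finset.prod_mul_distrib, prod_chain_castSucc fun m => vFun ev u (j m),
    prod_chain_succ fun m => vFun ev u (j m), Finset.prod_mul_distrib]
  ring

theorem prod_chebSum (R : ℝ) (phi : Fin d → ℝ → ℝ) (N : ℕ) (x : Fin d → ℝ) :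
    ∏ i, chebSum R (phi i) N (x i) = ∑ n : Fin d → Fin (N + 1),
      (∏ i, chebT R (n i) (x i)) * ∏ i, chebCoeff R (phi i) (n i) := by
  simp only [chebSum, Finset.sum_range]
  rw [Finset.prod_univ_sum, Fintype.piFinset_univ]
  exact Finset.sum_congr rfl fun n _ => by rw [Finset.prod_mul_distrib, mul_comm]

theorem funcHTrunc_eq_chainIntegral (hu : IsEigendecomposition lam h R ev u) (hR : 0 ≤ R)
    (J N : ℕ) (phi : Fin d → ℝ → ℝ) :
    funcHTrunc lam R ev u J N phi =
      cLam lam * chainIntegral (Icc (-R) R) (mercerSum ev u J) fun i => chebSum R (phi i) N := by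
  let F (j : Fin (d + 1) → Fin J) (n : Fin d → Fin (N + 1)) (i : Fin d) (y : ℝ) : ℝ :=
    vFun ev u (j i.castSucc) y * vFun ev u (j i.succ) y * chebT R (n i) y
  let c (j : Fin (d + 1) → Fin J) (n : Fin d → Fin (N + 1)) : ℝ :=
    vFun ev u (j 0) 0 * vFun ev u (j (Fin.last d)) 0 * ∏ i, chebCoeff R (phi i) (n i)
  have hexpand : ∀ x : Fin d → ℝ, chainProd (mercerSum ev u J) x * ∏ i, chebSum R (phi i) N (x i) =
      ∑ j, ∑ n, c j n * ∏ i, F j n i (x i) := fun x => by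
    rw [chainProd_mercerSum, prod_chebSum, Finset.sum_mul_sum]
    refine Finset.sum_congr rfl fun j _ => Finset.sum_congr rfl fun n _ => ?_
    rw [Finset.prod_mul_distrib (f := fun i => _ * _)]
    ring
  have hint : ∀ j n, Integrable (fun x : Fin d → ℝ => c j n * ∏ i, F j n i (x i))
      (Measure.pi fun _ => muI R) := fun j n =>
    (Integrable.fintype_prod fun i =>
      (((hu.continuousOn_vFun _).mul (hu.continuousOn_vFun _)).mul
        (continuous_chebT R _).continuousOn).integrableOn_Icc).const_mul _
  simp only [chainIntegral, restrict_univ_pi, hexpand]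
  rw [integral_finsetSum _ fun j _ => integrable_finsetSum _ fun n _ => hint j n, funcHTrunc]
  refine congrArg _ (Finset.sum_congr rfl fun j _ => ?_)
  rw [integral_finsetSum _ fun n _ => hint j n]
  refine Finset.sum_congr rfl fun n _ => ?_
  rw [integral_const_mul, integral_fintype_prod_eq_prod (F j n)]
  simp only [F, c, ← coefA_eq_integral_muI hR]
  ring

end Truncation

section SupNorm

variable {d p N : ℕ} {R : ℝ}

theorem abs_le_supNorm {f : ℝ → ℝ} (hR : 0 < R) (hf : ContinuousOn f (Icc (-R) R)) {x : ℝ}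
    (hx : x ∈ Icc (-R) R) : |f x| ≤ supNorm R f := by
  have hmem : MemLp f ∞ (muI R) := by
    obtain ⟨C, hC⟩ := isCompact_Icc.exists_bound_of_continuousOn hf
    refine MemLp.of_bound (hf.aestronglyMeasurable measurableSet_Icc) C ?_
    filter_upwards [ae_restrict_mem measurableSet_Icc] with x hx using hC x hx
  have hmin : (fun x => min |f x| (supNorm R f)) =ᵐ[muI R] fun x => |f x| := by
    filter_upwards [ae_le_lpNorm_exponent_top hmem] with y hy using min_eq_left hy
  exact min_eq_left_iff.1 (Measure.eqOn_Icc_of_ae_eq volume (by linarith : -R ≠ R) hmin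
    (hf.abs.inf continuousOn_const) hf.abs hx)

theorem supNorm_le_maxSupNorm (R : ℝ) (phi : Fin d → ℝ → ℝ) (i : Fin d) :
    supNorm R (phi i) ≤ maxSupNorm R phi :=
  le_ciSup (f := fun i => supNorm R (phi i)) (finite_range _).bddAbove i

theorem maxSupNorm_nonneg (R : ℝ) (phi : Fin d → ℝ → ℝ) : 0 ≤ maxSupNorm R phi :=
  Real.iSup_nonneg fun _ => lpNorm_nonneg

theorem derivL1Norm_le_Vp (R : ℝ) (p : ℕ) (phi : Fin d → ℝ → ℝ) (i : Fin d) :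
    derivL1Norm R p (phi i) ≤ Vp R p phi :=
  le_ciSup (f := fun i => derivL1Norm R p (phi i)) (finite_range _).bddAbove i

theorem Vp_nonneg (R : ℝ) (p : ℕ) (phi : Fin d → ℝ → ℝ) : 0 ≤ Vp R p phi :=
  Real.iSup_nonneg fun i => derivL1Norm_nonneg R p (phi i)

theorem chebTail_nonneg (hpN : p ≤ N) (R : ℝ) (phi : Fin d → ℝ → ℝ) : 0 ≤ chebTail R p N phi := by
  have hNp : (0 : ℝ) ≤ N - p := sub_nonneg.2 (by exact_mod_cast hpN)
  have := Vp_nonneg R p phi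
  unfold chebTail
  positivity

theorem abs_sub_chebSum_le_chebTail (hp : p ≠ 0) (hpN : p < N) {phi : Fin d → ℝ → ℝ} {i : Fin d}
    (hphi : ContDiffOn ℝ ((p + 1 : ℕ) : WithTop ℕ∞) (phi i) (Icc (-R) R)) {x : ℝ}
    (hx : x ∈ Icc (-R) R) : |phi i x - chebSum R (phi i) N x| ≤ chebTail R p N phi := by
  have hNp : (0 : ℝ) ≤ N - p := sub_nonneg.2 (by exact_mod_cast hpN.le)
  refine (abs_sub_chebSum_le hp hpN hphi hx).trans ?_
  unfold chebTail
  gcongr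
  exact derivL1Norm_le_Vp R p phi i

end SupNorm

section ErrorBounds

variable {d : ℕ} {lam h R : ℝ} {ev : ℕ → ℝ} {u : ℕ → ℝ → ℝ}

/-- The constant `M` of the eigenvalue truncation error `M e^{-αJ/2} ∏ᵢ ‖φᵢ‖_∞`. -/
def truncationConst (lam h R α : ℝ) (d : ℕ) : ℝ :=
  cLam lam * (d + 1) * (2 * R) ^ d * Real.exp (lam / h ^ 2 * R ^ 2 * Real.exp α / 2)

theorem cLam_pos (lam : ℝ) : 0 < cLam lam := Real.exp_pos _

theorem truncationConst_pos (hR : 0 < R) (lam h α : ℝ) (d : ℕ) :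
    0 < truncationConst lam h R α d := by
  have := cLam_pos lam
  unfold truncationConst
  positivity

theorem sqrt_two_mul_mul_eigenvalue_le (hu : IsEigendecomposition lam h R ev u) (hlam : 0 ≤ lam)
    (hR : 0 ≤ R) {α : ℝ} (hα : 0 ≤ α) (J : ℕ) :
    √(2 * R * ev J) ≤
      2 * R * Real.exp (lam / h ^ 2 * R ^ 2 * Real.exp α / 2) * Real.exp (-(α * J / 2)) := by
  have hexp_sq : ∀ t : ℝ, Real.exp (t / 2) ^ 2 = Real.exp t := fun t => by
    rw [← Real.exp_nat_mul, Nat.cast_ofNat, mul_div_cancel₀ _ two_ne_zero]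
  rw [Real.sqrt_le_iff]
  refine ⟨by positivity, (mul_le_mul_of_nonneg_left (hu.le_exp hlam hR hα J)
    (by positivity)).trans_eq ?_⟩
  rw [mul_pow, mul_pow, hexp_sq, ← neg_div, hexp_sq]
  ring

theorem abs_funcH_sub_chainIntegral_mercerSum_le (hu : IsEigendecomposition lam h R ev u)
    (hlam : 0 ≤ lam) (hR : 0 < R) {α : ℝ} (hα : 0 ≤ α) (hd : d ≠ 0) (J : ℕ)
    {phi : Fin d → ℝ → ℝ} (hphi : ∀ i, ContinuousOn (phi i) (Icc (-R) R)) :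
    |funcH lam h R phi - cLam lam * chainIntegral (Icc (-R) R) (mercerSum ev u J) phi| ≤
      truncationConst lam h R α d * Real.exp (-(α * J / 2)) * ∏ i, supNorm R (phi i) := by
  obtain ⟨n, rfl⟩ := Nat.exists_eq_add_one_of_ne_zero hd
  have hchain := abs_chainIntegral_sub_kernel_le isCompact_Icc ⟨by linarith, hR.le⟩
    (k := kernel lam h) (continuous_kernel lam h).continuousOn (continuousOn_mercerSum hu J) hphi
    (kernel_comm lam h) (mercerSum_comm ev u J)
    (fun x _ y _ => (abs_of_nonneg (kernel_nonneg lam h x y)).trans_le (kernel_le_one hlam h x y))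
    (fun x hx y hy => abs_mercerSum_le_one hu hlam hR J hx hy)
    (fun x hx => (integral_abs_kernel_sub_mercerSum_le hu hlam hR J hx).trans
      (sqrt_two_mul_mul_eigenvalue_le hu hlam hR.le hα J))
    fun i x hx => abs_le_supNorm hR (hphi i) hx
  rw [Real.volume_real_Icc_of_le (by linarith)] at hchain
  change |cLam lam * chainIntegral (Icc (-R) R) (kernel lam h) phi - _| ≤ _
  rw [← mul_sub, abs_mul, abs_of_pos (cLam_pos lam)]
  refine (mul_le_mul_of_nonneg_left hchain (cLam_pos lam).le).trans_eq ?_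
  rw [truncationConst]
  push_cast
  ring

theorem abs_chainIntegral_mercerSum_sub_funcHTrunc_le (hu : IsEigendecomposition lam h R ev u)
    (hlam : 0 ≤ lam) (hR : 0 < R) (J : ℕ) {p N : ℕ} (hp : p ≠ 0) (hpN : p < N)
    {phi : Fin d → ℝ → ℝ}
    (hphi : ∀ i, ContDiffOn ℝ ((p + 1 : ℕ) : WithTop ℕ∞) (phi i) (Icc (-R) R)) :
    |cLam lam * chainIntegral (Icc (-R) R) (mercerSum ev u J) phi -
        funcHTrunc lam R ev u J N phi| ≤
      d * cLam lam * chebTail R p N phi * (maxSupNorm R phi + chebTail R p N phi) ^ (d - 1) *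
        kernel lam h 0 0 * (∑' j, ev j) ^ d := by
  have h0 : (0 : ℝ) ∈ Icc (-R) R := ⟨by linarith, hR.le⟩
  have htail := chebTail_nonneg hpN.le R phi
  have hmax := maxSupNorm_nonneg R phi
  have hdiag := mercerSum_self_nonneg ev u J
  have hbound : ∀ i, ∀ x ∈ Icc (-R) R, |phi i x| ≤ maxSupNorm R phi := fun i x hx =>
    (abs_le_supNorm hR (hphi i).continuousOn hx).trans (supNorm_le_maxSupNorm R phi i)
  have happrox : ∀ i, ∀ x ∈ Icc (-R) R,
      |phi i x - chebSum R (phi i) N x| ≤ chebTail R p N phi := fun i x hx =>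
    abs_sub_chebSum_le_chebTail hp hpN (hphi i) hx
  have hchain := abs_chainIntegral_sub_factor_le isCompact_Icc h0 (continuousOn_mercerSum hu J)
    (r := fun x => √(mercerSum ev u J x x))
    ((continuousOn_mercerSum hu J).comp (continuousOn_id.prodMk continuousOn_id)
      fun _ hx => ⟨hx, hx⟩).sqrt
    (fun x _ y _ => abs_mercerSum_le ev u J x y) (fun i => (hphi i).continuousOn)
    (fun i => (continuous_chebSum R (phi i) N).continuousOn) (add_nonneg hmax htail)
    (fun i x hx => (hbound i x hx).trans (le_add_of_nonneg_right htail))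
    (fun i x hx => (norm_le_norm_add_norm_sub (phi i x) _).trans
      (add_le_add (hbound i x hx) (happrox i x hx)))
    happrox
  simp only [Real.sq_sqrt (hdiag _)] at hchain
  rw [funcHTrunc_eq_chainIntegral hu hR.le, ← mul_sub, abs_mul, abs_of_pos (cLam_pos lam)]
  calc cLam lam * _ ≤ cLam lam * _ := mul_le_mul_of_nonneg_left hchain (cLam_pos lam).le
    _ ≤ cLam lam * ((maxSupNorm R phi + chebTail R p N phi) ^ (d - 1) * (d * chebTail R p N phi) *
        (kernel lam h 0 0 * (∑' j, ev j) ^ d)) := by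
      have hc := cLam_pos lam
      gcongr
      exacts [pow_nonneg (integral_nonneg hdiag) d, kernel_nonneg lam h 0 0,
        mercerSum_self_le_kernel hu hlam hR J h0, integral_nonneg hdiag,
        integral_mercerSum_self_le hu hlam hR.le J]
    _ = _ := by ring

theorem abs_funcH_sub_funcHTrunc_le (hu : IsEigendecomposition lam h R ev u) (hlam : 0 ≤ lam)
    (hR : 0 < R) {α : ℝ} (hα : 0 ≤ α) (hd : d ≠ 0) (J : ℕ) {p N : ℕ} (hp : p ≠ 0) (hpN : p < N)
    {phi : Fin d → ℝ → ℝ}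
    (hphi : ∀ i, ContDiffOn ℝ ((p + 1 : ℕ) : WithTop ℕ∞) (phi i) (Icc (-R) R)) :
    |funcH lam h R phi - funcHTrunc lam R ev u J N phi| ≤
      truncationConst lam h R α d * Real.exp (-(α * J / 2)) * ∏ i, supNorm R (phi i) +
      d * cLam lam * chebTail R p N phi * (maxSupNorm R phi + chebTail R p N phi) ^ (d - 1) *
        kernel lam h 0 0 * (∑' j, ev j) ^ d :=
  (abs_sub_le _ _ _).trans (add_le_add
    (abs_funcH_sub_chainIntegral_mercerSum_le hu hlam hR hα hd J fun i => (hphi i).continuousOn)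
    (abs_chainIntegral_mercerSum_sub_funcHTrunc_le hu hlam hR J hp hpN hphi))

theorem add_pow_le_one_add_pow_mul_pow {m ε : ℝ} (hm : 1 ≤ m) (hε : 0 ≤ ε) (k : ℕ) :
    (m + ε) ^ k ≤ (1 + ε) ^ k * m ^ k := by
  rw [← mul_pow]
  gcongr
  nlinarith

theorem abs_funcH_sub_funcHTrunc_le_of_one_le_maxSupNorm
    (hu : IsEigendecomposition lam h R ev u) (hlam : 0 ≤ lam) (hR : 0 < R) {α : ℝ} (hα : 0 ≤ α)
    (hd : d ≠ 0) (J : ℕ) {p N : ℕ} (hp : p ≠ 0) (hpN : p < N) {phi : Fin d → ℝ → ℝ}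
    (hphi : ∀ i, ContDiffOn ℝ ((p + 1 : ℕ) : WithTop ℕ∞) (phi i) (Icc (-R) R))
    (hmax : 1 ≤ maxSupNorm R phi) :
    |funcH lam h R phi - funcHTrunc lam R ev u J N phi| ≤
      truncationConst lam h R α d * Real.exp (-(α * J / 2)) * ∏ i, supNorm R (phi i) +
      d * cLam lam * chebTail R p N phi * (1 + chebTail R p N phi) ^ (d - 1) *
        kernel lam h 0 0 * (∑' j, ev j) ^ d * maxSupNorm R phi ^ (d - 1) := by
  have htail := chebTail_nonneg hpN.le R phi
  have hc := cLam_pos lam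
  have hK := kernel_nonneg lam h 0 0
  have hTr : 0 ≤ ∑' j, ev j := tsum_nonneg hu.nonneg
  refine (abs_funcH_sub_funcHTrunc_le hu hlam hR hα hd J hp hpN hphi).trans
    (add_le_add_right ?_ _)
  calc d * cLam lam * chebTail R p N phi * (maxSupNorm R phi + chebTail R p N phi) ^ (d - 1) *
        kernel lam h 0 0 * (∑' j, ev j) ^ d
      ≤ d * cLam lam * chebTail R p N phi *
          ((1 + chebTail R p N phi) ^ (d - 1) * maxSupNorm R phi ^ (d - 1)) *
          kernel lam h 0 0 * (∑' j, ev j) ^ d := by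
        gcongr
        exact add_pow_le_one_add_pow_mul_pow hmax htail _
    _ = _ := by ring

end ErrorBounds

end

end GinzburgLandau

theorem mainTheorem1 (lam h R : ℝ) (hlam : 0 < lam) (hh : 0 < h) (hR : 0 < R) :
    IsCompactOperator (GinzburgLandau.opH0 lam h R) ∧
    (GinzburgLandau.opH0 lam h R).IsSymmetric ∧
    (GinzburgLandau.opH0 lam h R).IsPositive ∧
    (∃ (ev : ℕ → ℝ) (u : ℕ → ℝ → ℝ), GinzburgLandau.IsEigendecomposition lam h R ev u) ∧
    ∀ d : ℕ, 1 ≤ d → ∀ α : ℝ, 0 < α → ∃ M : ℝ, 0 < M ∧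
      ∀ (ev : ℕ → ℝ) (u : ℕ → ℝ → ℝ), GinzburgLandau.IsEigendecomposition lam h R ev u →
        Summable ev ∧
        ∀ (J N p : ℕ), 1 ≤ J → 1 ≤ p → p < N →
        ∀ phi : Fin d → ℝ → ℝ,
          (∀ i, ContDiffOn ℝ ((p + 1 : ℕ) : WithTop ℕ∞) (phi i) (Set.Icc (-R) R)) →
          (∀ i, ∀ x ∈ Set.Icc (-R) R,
            HasSum (fun n => GinzburgLandau.chebCoeff R (phi i) n * GinzburgLandau.chebT R n x)
              (phi i x)) ∧
          |GinzburgLandau.funcH lam h R phi - GinzburgLandau.funcHTrunc lam R ev u J N phi| ≤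
            M * Real.exp (-(α * J / 2)) * ∏ i, GinzburgLandau.supNorm R (phi i) +
            d * GinzburgLandau.cLam lam * GinzburgLandau.chebTail R p N phi *
              (GinzburgLandau.maxSupNorm R phi + GinzburgLandau.chebTail R p N phi) ^ (d - 1) *
              GinzburgLandau.kernel lam h 0 0 * (∑' j, ev j) ^ d ∧
          (1 ≤ GinzburgLandau.maxSupNorm R phi →
            |GinzburgLandau.funcH lam h R phi - GinzburgLandau.funcHTrunc lam R ev u J N phi| ≤
              M * Real.exp (-(α * J / 2)) * ∏ i, GinzburgLandau.supNorm R (phi i) +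
              d * GinzburgLandau.cLam lam * GinzburgLandau.chebTail R p N phi *
                (1 + GinzburgLandau.chebTail R p N phi) ^ (d - 1) *
                GinzburgLandau.kernel lam h 0 0 * (∑' j, ev j) ^ d *
                GinzburgLandau.maxSupNorm R phi ^ (d - 1)) := by
  open GinzburgLandau in
  have hexpansion := hasSum_rankOne_featureLp (h := h) hlam.le hR.le
  have hpos := isPositive_of_hasSum_rankOne hexpansion
  refine ⟨isCompactOperator_of_hasSum_rankOne hexpansion, hpos.isSymmetric, hpos,
    exists_isEigendecomposition hlam hh.ne' hR, fun d hd α hα =>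
    ⟨truncationConst lam h R α d, truncationConst_pos hR lam h α d, fun ev u hu =>
    ⟨hu.summable hlam.le hR.le, fun J N p _ hp hpN phi hphi => ⟨fun i x hx => ?_, ?_, ?_⟩⟩⟩⟩
  · exact hasSum_chebCoeff (hphi i).continuousOn
      (summable_abs_chebCoeff hR.le (by omega) (hphi i)) hx
  · exact abs_funcH_sub_funcHTrunc_le hu hlam.le hR hα.le (by omega) J (by omega) hpN hphi
  · exact abs_funcH_sub_funcHTrunc_le_of_one_le_maxSupNorm hu hlam.le hR hα.le (by omega) J
      (by omega) hpN hphi
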